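/- Combinatorial Product Theorem. Let $P\subset\mathbb R^m$ and $Q\subset\mathbb R^n$ be lattice polytopes of dimension $m$ and $n$, respectively, and let $P^\lambda$ and $Q^\mu$ be rdf-triangulations of $P$ and $Q$. Fix color consecutive orderings of the vertices of $P^\lambda$ and of $Q^\mu$. Then the simplicial product $P^\lambda\boxtimes Q^\mu$ with respect to these orderings is an rdf-triangulation of the $(m+n)$-dimensional lattice polytope $P\times Q\subset\mathbb R^{m+n}$, and its signature is \[\sigma(P^\lambda\boxtimes Q^\mu)=\sigma_{m,n}\,\sigma(P^\lambda)\,\sigma(Q^\mu).\] Here a triangulation $K$ of an $m$-dimensional lattice polytope $P\subset\mathbb R^m$ is called an rdf-triangulation if it is: regular, i.e. it is the subdivision of $P$ induced by the lower convex hull of the points $(v,\lambda(v))$, $v$ a vertex of $K$, for some convex function $\lambda:\mathbb R^m\to\mathbb R$; dense, i.e. its vertex set is $P\cap\mathbb Z^m$; and foldable, i.e. its vertices can be colored with $m+1$ colors $0,\dots,m$ such that the vertices of each face have pairwise distinct colors. A linear ordering of the vertices of $K$ is color consecutive if some such coloring is weakly monotone with respect to it. The simplicial product $K\boxtimes L$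 of complexes with linearly ordered vertex sets $V_K$, $V_L$ consists of all nonempty finite sets $F\subseteq V_K\times V_L$ whose projections to $V_K$ and $V_L$ are faces of $K$ and of $L$ and which are totally ordered by the product ordering ($(v,w)\le(v',w')$ if and only if $v\le v'$ and $w\le w'$). The dual graph of $K$ has the facets as nodes, two of them being adjacent if they differ in one vertex; for the complexes considered here it is connected and bipartite. The signature $\sigma(K)$ is the absolute value of the difference between the numbers of facets of odd normalized volume ($m!$ times the Lebesgue measure) in the two classes of the bipartition. Finally, $\sigma_{m,n}$ is the signature of the staircase triangulation of $\Delta_m\times\Delta_n$, where $\Delta_k=\operatorname{conv}(e_0,e_1,\dots,e_k)\subset\mathbb R^k$ with $e_0=0$: its facets are the vertex sets $\{(e_i,e_j):(i,j)\in\pi\}$, where $\pi$ runs over the lattice paths from $(0,0)$ to $(m,n)$ with unit steps to the right or up. -/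

import Mathlib

namespace RdfTriangulation

noncomputable section

open scoped Classical

/-! ### Simplicial complexes given by their (nonempty) faces -/

/-- The vertices of a simplicial complex are its one-element faces. -/
def vertices {α : Type*} (K : Set (Finset α)) : Set α := {v | {v} ∈ K}

/-- A facet is a face that is maximal with respect to inclusion. -/
def IsFacet {α : Type*} (K : Set (Finset α)) (s : Finset α) : Prop :=
  Maximal (fun t => t ∈ K) s

/-- The dual graph: the nodes are the facets, and two facets are adjacent if they differ in exactly
one vertex. -/
def dualGraph {α : Type*} (K : Set (Finset α)) : SimpleGraph {s : Finset α // IsFacet K s} where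
  Adj f g := (f.1 \ g.1).card = 1 ∧ (g.1 \ f.1).card = 1
  symm := ⟨fun _ _ h => ⟨h.2, h.1⟩⟩
  loopless := ⟨fun f h => by simp at h⟩

/-- A vertex coloring with `m + 1` colors: the vertices of every face get pairwise distinct colors,
that is, `c` induces a non-degenerate simplicial map to the `m`-simplex. (The values of `c` away
from the vertices of `K` play no role.) -/
def IsColoring {α : Type*} (m : ℕ) (K : Set (Finset α)) (c : α → Fin (m + 1)) : Prop :=
  ∀ s ∈ K, Set.InjOn c (s : Set α)

/-- `K` is a pure simplicial complex of dimension `m` with an `(m + 1)`-coloring. -/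
def IsFoldable {α : Type*} (m : ℕ) (K : Set (Finset α)) : Prop :=
  (∀ s, IsFacet K s → s.card = m + 1) ∧ ∃ c : α → Fin (m + 1), IsColoring m K c

/-- The relation `r` restricts to a (non-strict) linear ordering of the set `V`. -/
structure IsLinearOrderingOn {α : Type*} (V : Set α) (r : α → α → Prop) : Prop where
  refl : ∀ v ∈ V, r v v
  antisymm : ∀ v ∈ V, ∀ w ∈ V, r v w → r w v → v = w
  trans : ∀ u ∈ V, ∀ v ∈ V, ∀ w ∈ V, r u v → r v w → r u w
  total : ∀ v ∈ V, ∀ w ∈ V, r v w ∨ r w v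

/-- The relation `r` is a linear ordering of the vertices of `K` with respect to which some
`(m + 1)`-coloring of `K` is weakly monotone. -/
def IsColorConsecutive {α : Type*} (m : ℕ) (K : Set (Finset α)) (r : α → α → Prop) : Prop :=
  IsLinearOrderingOn (vertices K) r ∧
    ∃ c : α → Fin (m + 1), IsColoring m K c ∧
      ∀ v ∈ vertices K, ∀ w ∈ vertices K, r v w → c v ≤ c w

/-! ### Lattice polytopes and their triangulations -/

/-- A full-dimensional lattice polytope in `ℝ^ι`. -/
def IsLatticePolytope {ι : Type*} (P : Set (ι → ℝ)) : Prop :=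
  (∃ S : Finset (ι → ℤ), P = convexHull ℝ ((fun z i => (z i : ℝ)) '' (S : Set (ι → ℤ)))) ∧
    affineSpan ℝ P = ⊤

/-- The points of the integer lattice. -/
def latticePoints (ι : Type*) : Set (ι → ℝ) := Set.range (fun (z : ι → ℤ) i => (z i : ℝ))

/-- `K` is the set of faces of a finite geometric simplicial complex that covers exactly `P`. -/
def IsTriangulation {ι : Type*} (K : Set (Finset (ι → ℝ))) (P : Set (ι → ℝ)) : Prop :=
  K.Finite ∧ ∃ T : Geometry.SimplicialComplex ℝ (ι → ℝ), T.faces = K ∧ T.space = P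

/-- The cells, given by their vertices, of the polyhedral subdivision induced by the lower convex
hull of the lifted points `(v, lam v)`, `v ∈ V`: a cell consists of the points of `V` at which
a non-vertical hyperplane below all the lifted points is attained. -/
def lowerCells {ι : Type*} (V : Set (ι → ℝ)) (lam : (ι → ℝ) → ℝ) : Set (Finset (ι → ℝ)) :=
  {s | s.Nonempty ∧ ∃ l : (ι → ℝ) →ᵃ[ℝ] ℝ,
    (∀ v ∈ V, l v ≤ lam v) ∧ ∀ v, v ∈ s ↔ v ∈ V ∧ l v = lam v}

/-- `K` is the subdivision induced by a convex lifting function. -/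
def IsRegular {ι : Type*} (K : Set (Finset (ι → ℝ))) : Prop :=
  ∃ lam : (ι → ℝ) → ℝ, ConvexOn ℝ Set.univ lam ∧ K = lowerCells (vertices K) lam

/-- Regular, dense, foldable triangulations of a full-dimensional polytope `P` in `ℝ^ι`. -/
structure IsRdfTriangulation {ι : Type*} [Fintype ι] (K : Set (Finset (ι → ℝ)))
    (P : Set (ι → ℝ)) : Prop where
  triangulation : IsTriangulation K P
  regular : IsRegular K
  dense : vertices K = P ∩ latticePoints ι
  foldable : IsFoldable (Fintype.card ι) K

/-- The normalized volume `m! vol(S)`, where `m` is the dimension of the ambient space. -/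
def normalizedVolume {ι : Type*} [Fintype ι] (S : Set (ι → ℝ)) : ℝ :=
  ((Fintype.card ι).factorial : ℝ) * (MeasureTheory.volume S).toReal

/-- The simplex with the given vertices has odd normalized volume. -/
def IsOddSimplex {ι : Type*} [Fintype ι] (s : Finset (ι → ℝ)) : Prop :=
  ∃ k : ℕ, Odd k ∧ normalizedVolume (convexHull ℝ (s : Set (ι → ℝ))) = k

/-- The absolute value of the number of odd facets of one color minus the number of odd facets of
the other color, for a 2-coloring of the facets. -/
def colorDifference {ι : Type*} [Fintype ι] (K : Set (Finset (ι → ℝ)))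
    (b : (dualGraph K).Coloring Bool) : ℕ :=
  ((({f | b f = true ∧ IsOddSimplex f.1}.ncard : ℕ) : ℤ) -
    (({f | b f = false ∧ IsOddSimplex f.1}.ncard : ℕ) : ℤ)).natAbs

/-- The signature, computed from a 2-coloring of the (bipartite) dual graph. For a foldable
triangulation of a full-dimensional polytope the dual graph is bipartite and connected, so that the
2-coloring is unique up to exchanging the two colors, and the signature does not depend on it. -/
def signature {ι : Type*} [Fintype ι] (K : Set (Finset (ι → ℝ))) : ℕ :=
  if h : Nonempty ((dualGraph K).Coloring Bool) then colorDifference K h.some else 0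

/-! ### Products -/

/-- The product of `P ⊆ ℝ^ι` and `Q ⊆ ℝ^κ` as a subset of `ℝ^ι × ℝ^κ = ℝ^(ι ⊕ κ)`. -/
def productSet {ι κ : Type*} (P : Set (ι → ℝ)) (Q : Set (κ → ℝ)) : Set (ι ⊕ κ → ℝ) :=
  {z | (fun i => z (Sum.inl i)) ∈ P ∧ (fun j => z (Sum.inr j)) ∈ Q}

/-- The simplicial product with respect to the vertex orderings `r` and `r'`: the sets of points
whose projections are faces and on which the product ordering is total. -/
def simplicialProduct {ι κ : Type*} (K : Set (Finset (ι → ℝ))) (L : Set (Finset (κ → ℝ)))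
    (r : (ι → ℝ) → (ι → ℝ) → Prop) (r' : (κ → ℝ) → (κ → ℝ) → Prop) :
    Set (Finset (ι ⊕ κ → ℝ)) :=
  {F | F.image (fun z i => z (Sum.inl i)) ∈ K ∧ F.image (fun z j => z (Sum.inr j)) ∈ L ∧
    ∀ x ∈ F, ∀ y ∈ F,
      (r (fun i => x (Sum.inl i)) (fun i => y (Sum.inl i)) ∧
        r' (fun j => x (Sum.inr j)) (fun j => y (Sum.inr j))) ∨
      (r (fun i => y (Sum.inl i)) (fun i => x (Sum.inl i)) ∧
        r' (fun j => y (Sum.inr j)) (fun j => x (Sum.inr j)))}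

/-! ### The staircase triangulation of a product of standard simplices -/

/-- The vertices `0, e_1, …, e_m` of the standard simplex. -/
def simplexVertex (m : ℕ) : Fin (m + 1) → (Fin m → ℝ) :=
  Fin.cases 0 (fun i => Pi.single i 1)

/-- Paths in the grid of size `(m + 1) × (n + 1)` from the lower left to the upper right node all
of whose steps go one node to the right or one node up. -/
def IsStaircase (m n : ℕ) (p : Fin (m + n + 1) → Fin (m + 1) × Fin (n + 1)) : Prop :=
  p 0 = (0, 0) ∧ p (Fin.last (m + n)) = (Fin.last m, Fin.last n) ∧
    ∀ i : Fin (m + n),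
      (((p i.succ).1 : ℕ) = (p i.castSucc).1 + 1 ∧ (p i.succ).2 = (p i.castSucc).2) ∨
      ((p i.succ).1 = (p i.castSucc).1 ∧ ((p i.succ).2 : ℕ) = (p i.castSucc).2 + 1)

/-- The vertex of the product of two standard simplices that corresponds to a node of the grid. -/
def gridVertex (m n : ℕ) (a : Fin (m + 1) × Fin (n + 1)) : Fin m ⊕ Fin n → ℝ :=
  Sum.elim (simplexVertex m a.1) (simplexVertex n a.2)

/-- The staircase triangulation: its facets are the vertex sets of the staircases. -/
def staircaseTriangulation (m n : ℕ) : Set (Finset (Fin m ⊕ Fin n → ℝ)) :=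
  {s | s.Nonempty ∧ ∃ p, IsStaircase m n p ∧
    s ⊆ Finset.univ.image (fun i => gridVertex m n (p i))}

/-- The signature of the staircase triangulation. -/
def staircaseSignature (m n : ℕ) : ℕ := signature (staircaseTriangulation m n)

end

end RdfTriangulation

namespace RdfTriangulation

noncomputable section

open scoped Classical

/-! ### Geometric complexes and barycentric weights -/

section Weights

variable {E : Type*}

/-! The signature is an orientation count. In a foldable triangulation every facet can be listed by
colour, and the determinant `edgeDet` of its edge vectors in that order has a sign. Adjacent facets
differ in one vertex of a common colour, and the two versions of it lie on opposite sides of the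
shared wall, so the signs are opposite (`det_mul_neg_of_adj`). The sign is therefore a proper
2-coloring of the dual graph. That graph is connected (`mem_of_adj_closed`), because a generic
segment between two facets misses all faces of codimension two. Hence any 2-coloring is this one or
its opposite, and, the absolute determinant being the normalized volume, the signature is the
absolute value of a sum of `oddSign`s of determinants (`signature_eq`).

For the product, the vertex orderings are replaced by injective integer ranks. Covering and proper
intersection then become one-dimensional optimal transport: a point of the product is a pair of
probability weights on faces of the factors, and such a pair has exactly one coupling supported on a
chain. Existence (`exists_monotone_coupling`) gives the covering, uniqueness
(`weight_eq_of_marginals`) the intersection property. To suit this, `IsComplex` encodes independence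
and intersection together as uniqueness of weights.

Colors grow weakly along a chain, so the sum of the two colors is a coloring of the product, and a
facet of the product is a facet of each factor together with a staircase (`bijOn_pathFacet`). Its
determinant is the product of three determinants (`edgeDet_pathFacet`) and `oddSign` is
multiplicative on integers, so the signed counts multiply. The staircase triangulation is itself
such a product, with both factors of signed count 1, which identifies the remaining factor.

For regularity, the sum of the two lifts induces the subdivision into products of faces. Subtracting
a small multiple of the supermodular function `thresholdCount` refines it: dual potentials of the
transport problem (`exists_potential`) certify each chain as a lower cell. Once all faces are lower
cells there are no others (`eq_lowerCells`), and a maximum of supporting affine functions turns the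
lift into a convex one. -/

/-- A nonnegative weight function supported on `s`. -/
structure IsWeight (s : Finset E) (w : E → ℝ) : Prop where
  nonneg : ∀ v, 0 ≤ w v
  zero : ∀ v, v ∉ s → w v = 0

lemma IsWeight.mono {s t : Finset E} {w : E → ℝ} (h : IsWeight s w) (hst : s ⊆ t) :
    IsWeight t w :=
  ⟨h.nonneg, fun v hv => h.zero v fun hs => hv (hst hs)⟩

lemma IsWeight.sum_eq {M : Type*} [AddCommGroup M] [Module ℝ M] {s t : Finset E} {w : E → ℝ}
    (h : IsWeight s w) (hst : s ⊆ t) (f : E → M) : ∑ v ∈ s, w v • f v = ∑ v ∈ t, w v • f v :=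
  Finset.sum_subset hst fun v _ hv => by rw [h.zero v hv, zero_smul]

lemma IsWeight.total_eq {s t : Finset E} {w : E → ℝ}
    (h : IsWeight s w) (hst : s ⊆ t) : ∑ v ∈ s, w v = ∑ v ∈ t, w v :=
  Finset.sum_subset hst fun v _ hv => h.zero v hv

lemma IsWeight.eq_zero {s : Finset E} {w : E → ℝ} (h : IsWeight s w) (h0 : ∑ v ∈ s, w v = 0) :
    w = 0 := by
  funext v
  by_cases hv : v ∈ s
  · exact (Finset.sum_eq_zero_iff_of_nonneg fun v _ => h.nonneg v).1 h0 v hv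
  · exact h.zero v hv

/-- The restriction of a weight function to a finite set containing its support. -/
lemma isWeight_indicator {s : Finset E} {w : E → ℝ} (h : ∀ v ∈ s, 0 ≤ w v) :
    IsWeight s (fun v => if v ∈ s then w v else 0) where
  nonneg v := by
    split_ifs with hv
    · exact h v hv
    · exact le_rfl
  zero v hv := if_neg hv

lemma IsWeight.smul {s : Finset E} {w : E → ℝ} (h : IsWeight s w) {c : ℝ} (hc : 0 ≤ c) :
    IsWeight s (fun v => c * w v) :=
  ⟨fun v => mul_nonneg hc (h.nonneg v), fun v hv => by simp [h.zero v hv]⟩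

variable [AddCommGroup E] [Module ℝ E]

lemma mem_convexHull_iff_weight {s : Finset E} {x : E} :
    x ∈ convexHull ℝ (s : Set E) ↔
      ∃ w, IsWeight s w ∧ ∑ v ∈ s, w v = 1 ∧ ∑ v ∈ s, w v • v = x := by
  rw [Finset.mem_convexHull']
  constructor
  · rintro ⟨w, h0, h1, hx⟩
    refine ⟨_, isWeight_indicator h0, ?_, ?_⟩
    · rw [← h1]
      exact Finset.sum_congr rfl fun v hv => if_pos hv
    · rw [← hx]
      exact Finset.sum_congr rfl fun v hv => by rw [if_pos hv]
  · rintro ⟨w, h0, h1, hx⟩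
    exact ⟨w, fun v _ => h0.nonneg v, h1, hx⟩

/-- A weight function on a face is determined by its mass and its moment. -/
def UniqueWeights (K : Set (Finset E)) : Prop :=
  ∀ s ∈ K, ∀ t ∈ K, ∀ w w' : E → ℝ, IsWeight s w → IsWeight t w' →
    ∑ v ∈ s, w v = ∑ v ∈ t, w' v → ∑ v ∈ s, w v • v = ∑ v ∈ t, w' v • v → w = w'

/-- The faces of a geometric simplicial complex. -/
structure IsComplex (K : Set (Finset E)) : Prop where
  nonempty : ∀ s ∈ K, s.Nonempty
  down : ∀ s ∈ K, ∀ t ⊆ s, t.Nonempty → t ∈ K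
  unique : UniqueWeights K

lemma affineIndependent_finset_iff {s : Finset E} :
    AffineIndependent ℝ ((↑) : s → E) ↔ ∀ w : E → ℝ, ∑ v ∈ s, w v = 0 →
      ∑ v ∈ s, w v • v = 0 → ∀ v ∈ s, w v = 0 := by
  rw [affineIndependent_iff]
  constructor
  · intro h w h0 h1 v hv
    refine h Finset.univ (fun v => w v) ?_ ?_ ⟨v, hv⟩ (Finset.mem_univ _)
    · rw [← h0]
      exact Finset.sum_coe_sort s w
    · rw [← h1]
      exact Finset.sum_coe_sort s fun v => w v • v
  · intro h u w h0 h1 e he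
    let w' : E → ℝ := fun v => if hv : v ∈ s then if ⟨v, hv⟩ ∈ u then w ⟨v, hv⟩ else 0 else 0
    have hw : ∀ v : s, w' v = if v ∈ u then w v else 0 := fun v => by simp [w']
    have := h w' ?_ ?_ e e.2
    · simpa [hw, he] using this
    · rw [← Finset.sum_coe_sort]
      simp_rw [hw]
      rw [Finset.sum_ite_mem, Finset.univ_inter, h0]
    · rw [← Finset.sum_coe_sort]
      simp_rw [hw, ite_smul, zero_smul]
      rw [Finset.sum_ite_mem, Finset.univ_inter, h1]

/-- After division by the mass, both weights represent one point `x` in the hulls of `s` and `t`,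
hence in the hull of `s ∩ t`. Affine independence of `s` and of `t` forces either weight to be the
one that represents `x` on `s ∩ t`. -/
lemma isComplex_faces (T : Geometry.SimplicialComplex ℝ E) : IsComplex T.faces where
  nonempty s hs := T.nonempty_of_mem_faces hs
  down s hs t hts ht := T.down_closed hs hts ht
  unique := by
    intro s hs t ht w w' hw hw' h0 h1
    by_cases hc : ∑ v ∈ s, w v = 0
    · rw [hw.eq_zero hc, hw'.eq_zero (h0 ▸ hc)]
    set c := ∑ v ∈ s, w v with hcdef
    have hcpos : 0 < c := lt_of_le_of_ne (Finset.sum_nonneg fun v _ => hw.nonneg v) (Ne.symm hc)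
    set x := c⁻¹ • ∑ v ∈ s, w v • v with hx
    have key : ∀ (r : Finset E) (u : E → ℝ), IsWeight r u → ∑ v ∈ r, u v = c →
        ∑ v ∈ r, u v • v = ∑ v ∈ s, w v • v → x ∈ convexHull ℝ (r : Set E) := by
      intro r u hu h2 h3
      refine mem_convexHull_iff_weight.2 ⟨_, hu.smul (inv_nonneg.2 hcpos.le), ?_, ?_⟩
      · rw [← Finset.mul_sum, h2, inv_mul_cancel₀ hc]
      · simp_rw [mul_smul]
        rw [← Finset.smul_sum, h3]
    have hxst := T.inter_subset_convexHull hs ht ⟨key s w hw rfl rfl, key t w' hw' h0.symm h1.symm⟩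
    rw [← Finset.coe_inter, mem_convexHull_iff_weight] at hxst
    obtain ⟨u, hu, hu1, hux⟩ := hxst
    have key2 : ∀ (r : Finset E) (y : E → ℝ), r ∈ T.faces → IsWeight r y → s ∩ t ⊆ r →
        ∑ v ∈ r, y v = c → ∑ v ∈ r, y v • v = ∑ v ∈ s, w v • v → y = fun v => c * u v := by
      intro r y hr hy hsub h2 h3
      have := affineIndependent_finset_iff.1 (T.indep hr) (fun v => y v - c * u v) ?_ ?_
      · funext v
        by_cases hv : v ∈ r
        · exact sub_eq_zero.1 (this v hv)
        · rw [hy.zero v hv, hu.zero v fun h => hv (hsub h), mul_zero]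
      · rw [Finset.sum_sub_distrib, h2, ← Finset.mul_sum, ← hu.total_eq hsub, hu1, mul_one, sub_self]
      · simp_rw [sub_smul, mul_smul]
        rw [Finset.sum_sub_distrib, h3, ← Finset.smul_sum, ← hu.sum_eq hsub fun v => v, hux, hx,
          smul_inv_smul₀ hc, sub_self]
    rw [key2 s w hs hw Finset.inter_subset_left rfl rfl,
      key2 t w' ht hw' Finset.inter_subset_right h0.symm h1.symm]

lemma UniqueWeights.affineIndependent {K : Set (Finset E)} (h : UniqueWeights K) {s : Finset E}
    (hs : s ∈ K) : AffineIndependent ℝ ((↑) : s → E) := by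
  rw [affineIndependent_finset_iff]
  intro w h0 h1 v hv
  have hp : ∀ v, (if v ∈ s then max (w v) 0 else 0) - (if v ∈ s then max (-w v) 0 else 0) =
      if v ∈ s then w v else 0 := by
    intro v
    split_ifs
    · exact max_zero_sub_max_neg_zero_eq_self (w v)
    · simp
  -- An affine dependence is split into its positive and negative parts: two weights on the same
  -- face with equal mass and moment.
  have := h s hs s hs _ _ (isWeight_indicator (w := fun v => max (w v) 0) fun v _ => le_max_right _ _)
    (isWeight_indicator (w := fun v => max (-w v) 0) fun v _ => le_max_right _ _) ?_ ?_
  · have h2 := hp v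
    rw [congrFun this v, sub_self, if_pos hv] at h2
    exact h2.symm
  · rw [← sub_eq_zero, ← Finset.sum_sub_distrib]
    exact (Finset.sum_congr rfl fun v hv => by rw [hp, if_pos hv]).trans h0
  · rw [← sub_eq_zero, ← Finset.sum_sub_distrib]
    refine (Finset.sum_congr rfl fun v hv => ?_).trans h1
    rw [← sub_smul, hp, if_pos hv]

/-- The geometric simplicial complex with the given faces. -/
def IsComplex.toSimplicialComplex {K : Set (Finset E)} (h : IsComplex K) :
    Geometry.SimplicialComplex ℝ E where
  faces := K
  isRelLowerSet_faces := fun s hs => ⟨h.nonempty s hs, fun t hts ht => h.down s hs t hts ht⟩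
  indep hs := h.unique.affineIndependent hs
  inter_subset_convexHull := by
    rintro s t hs ht x ⟨hxs, hxt⟩
    rw [← Finset.coe_inter]
    rw [mem_convexHull_iff_weight] at hxs hxt ⊢
    obtain ⟨w, hw, hw1, hwx⟩ := hxs
    obtain ⟨w', hw', hw1', hwx'⟩ := hxt
    have heq := h.unique s hs t ht w w' hw hw' (hw1.trans hw1'.symm) (hwx.trans hwx'.symm)
    -- Being equal to `w'`, the weight `w` vanishes off `t` as well as off `s`.
    have hst : IsWeight (s ∩ t) w := by
      refine ⟨hw.nonneg, fun v hv => ?_⟩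
      by_cases hvs : v ∈ s
      · rw [heq]
        exact hw'.zero v fun hvt => hv (Finset.mem_inter.2 ⟨hvs, hvt⟩)
      · exact hw.zero v hvs
    refine ⟨w, hst, ?_, ?_⟩
    · rw [hst.total_eq Finset.inter_subset_left, hw1]
    · rw [hst.sum_eq Finset.inter_subset_left fun v => v, hwx]

end Weights

lemma isTriangulation_iff {ι : Type*} {K : Set (Finset (ι → ℝ))} {P : Set (ι → ℝ)} :
    IsTriangulation K P ↔ K.Finite ∧ IsComplex K ∧
      ∀ x, x ∈ P ↔ ∃ s ∈ K, x ∈ convexHull ℝ (s : Set (ι → ℝ)) := by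
  constructor
  · rintro ⟨hf, T, rfl, rfl⟩
    exact ⟨hf, isComplex_faces T, fun x => T.mem_space_iff⟩
  · rintro ⟨hf, hK, hP⟩
    refine ⟨hf, hK.toSimplicialComplex, rfl, ?_⟩
    ext x
    rw [hP, Geometry.SimplicialComplex.mem_space_iff]
    rfl

lemma finite_vertices {E : Type*} {K : Set (Finset E)} (hK : K.Finite) : (vertices K).Finite :=
  hK.preimage (Finset.singleton_injective.injOn)

lemma exists_isFacet_superset {E : Type*} {K : Set (Finset E)} (hK : K.Finite) {s : Finset E} (hs : s ∈ K) :
    ∃ t, IsFacet K t ∧ s ⊆ t := by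
  obtain ⟨t, hst, ht⟩ := hK.exists_le_maximal hs
  exact ⟨t, ht, hst⟩

section Complex

variable {E : Type*} [AddCommGroup E] [Module ℝ E] {K : Set (Finset E)}

lemma IsComplex.mem_vertices (hK : IsComplex K) {s : Finset E} (hs : s ∈ K) {v : E} (hv : v ∈ s) :
    v ∈ vertices K :=
  hK.down s hs {v} (Finset.singleton_subset_iff.2 hv) (Finset.singleton_nonempty v)

/-- A face all of whose vertices have positive weight at a point of another face is contained in
that face. -/
lemma IsComplex.subset_of_pos (hK : IsComplex K) {s t : Finset E} (hs : s ∈ K) (ht : t ∈ K)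
    {w : E → ℝ} (hw : IsWeight s w) (hpos : ∀ v ∈ s, 0 < w v) (h1 : ∑ v ∈ s, w v = 1)
    (hx : ∑ v ∈ s, w v • v ∈ convexHull ℝ (t : Set E)) : s ⊆ t := by
  obtain ⟨w', hw', hw1', hwx'⟩ := mem_convexHull_iff_weight.1 hx
  have heq := hK.unique s hs t ht w w' hw hw' (h1.trans hw1'.symm) hwx'.symm
  intro v hv
  by_contra hvt
  exact (hpos v hv).ne' (heq ▸ hw'.zero v hvt)

end Complex

/-! ### Triangulations of full-dimensional convex sets -/

section FullDimensional

lemma exists_pos_weight {E : Type*} {s : Finset E} (hs : s.Nonempty) :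
    ∃ w : E → ℝ, IsWeight s w ∧ (∀ v ∈ s, 0 < w v) ∧ ∑ v ∈ s, w v = 1 := by
  have hc : (0 : ℝ) < s.card := by exact_mod_cast hs.card_pos
  refine ⟨_, isWeight_indicator (w := fun _ => (s.card : ℝ)⁻¹) fun v _ => (inv_pos.2 hc).le,
    fun v hv => ?_, ?_⟩
  · rw [if_pos hv]
    exact inv_pos.2 hc
  · rw [Finset.sum_ite_mem, Finset.inter_self, Finset.sum_const, nsmul_eq_mul,
      mul_inv_cancel₀ hc.ne']

lemma isClosed_convexHull_finset {ι : Type*} (s : Finset (ι → ℝ)) :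
    IsClosed (convexHull ℝ (s : Set (ι → ℝ))) :=
  s.finite_toSet.isClosed_convexHull ℝ

variable {ι : Type*} [Fintype ι] {K : Set (Finset (ι → ℝ))} {P : Set (ι → ℝ)}

lemma affineSpan_ne_top_of_card_le {t : Finset (ι → ℝ)} (ht : t.card ≤ Fintype.card ι) :
    affineSpan ℝ (t : Set (ι → ℝ)) ≠ ⊤ := by
  intro h
  rcases t.eq_empty_or_nonempty with rfl | hne
  · simp at h
  · have h1 := finrank_vectorSpan_image_finset_le ℝ (id : (ι → ℝ) → ι → ℝ) t (n := t.card - 1)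
      (by have := hne.card_pos; omega)
    rw [Finset.image_id, AffineSubspace.vectorSpan_eq_top_of_affineSpan_eq_top _ _ _ h,
      finrank_top, Module.finrank_pi] at h1
    have := hne.card_pos
    omega

lemma IsComplex.card_le (hK : IsComplex K) {s : Finset (ι → ℝ)} (hs : s ∈ K) :
    s.card ≤ Fintype.card ι + 1 := by
  have h := (hK.unique.affineIndependent hs).card_le_finrank_succ
  have h2 := Submodule.finrank_le (vectorSpan ℝ (Set.range ((↑) : s → ι → ℝ)))
  rw [Module.finrank_pi] at h2
  rw [Fintype.card_coe] at h
  omega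

/-- Triangulations of full-dimensional convex sets are pure. -/
lemma IsTriangulation.card_facet (hK : IsTriangulation K P) (hP : Convex ℝ P)
    (hint : (interior P).Nonempty) {s : Finset (ι → ℝ)} (hs : IsFacet K s) :
    s.card = Fintype.card ι + 1 := by
  obtain ⟨hf, hC, hcov⟩ := isTriangulation_iff.1 hK
  refine le_antisymm (hC.card_le hs.prop) ?_
  by_contra! hlt
  obtain ⟨w, hw, hpos, hw1⟩ := exists_pos_weight (hC.nonempty s hs.prop)
  set x := ∑ v ∈ s, w v • v with hx
  have hxs : x ∈ convexHull ℝ (s : Set (ι → ℝ)) := mem_convexHull_iff_weight.2 ⟨w, hw, hw1, rfl⟩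
  -- The barycenter `x` of the facet `s` lies in no other face, so a whole neighborhood of it meets
  -- `P` only inside the hull of `s`. If `s` had too few vertices, some `y ∈ P` would lie off its
  -- affine span, and a short step from `x` towards `y` would leave the hull of `s`.
  have hU : IsOpen (⋃ t ∈ K \ {s}, convexHull ℝ (t : Set (ι → ℝ)))ᶜ :=
    (hf.sdiff.isClosed_biUnion fun t _ => isClosed_convexHull_finset t).isOpen_compl
  have hxU : x ∈ (⋃ t ∈ K \ {s}, convexHull ℝ (t : Set (ι → ℝ)))ᶜ := by
    simp only [Set.mem_compl_iff, Set.mem_iUnion, not_exists]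
    intro t ht hxt
    have hst := hC.subset_of_pos hs.prop ht.1 hw hpos hw1 hxt
    exact ht.2 (hs.eq_of_le ht.1 hst).symm
  have hspan := affineSpan_ne_top_of_card_le (Nat.lt_succ_iff.1 hlt)
  obtain ⟨y, hyP, hys⟩ : ∃ y ∈ P, y ∉ affineSpan ℝ (s : Set (ι → ℝ)) := by
    by_contra! hall
    apply hspan
    rw [eq_top_iff, ← hP.interior_nonempty_iff_affineSpan_eq_top.1 hint]
    exact affineSpan_le.2 hall
  have hxP : x ∈ P := (hcov x).2 ⟨s, hs.prop, hxs⟩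
  have hcont : Continuous fun e : ℝ => AffineMap.lineMap x y e := by fun_prop
  have hev : ∀ᶠ e in nhdsWithin (0 : ℝ) (Set.Ioi 0), AffineMap.lineMap x y e ∈
      (⋃ t ∈ K \ {s}, convexHull ℝ (t : Set (ι → ℝ)))ᶜ := by
    refine nhdsWithin_le_nhds (hcont.continuousAt.eventually_mem (hU.mem_nhds ?_))
    simpa using hxU
  obtain ⟨e, he1, he2, he3⟩ := (hev.and (Ioo_mem_nhdsGT (zero_lt_one' ℝ))).exists
  obtain ⟨t, ht, hzt⟩ := (hcov _).1 (hP.lineMap_mem hxP hyP ⟨he2.le, he3.le⟩)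
  have hts : t = s := by
    by_contra hne
    exact he1 (Set.mem_biUnion (⟨ht, hne⟩ : t ∈ K \ {s}) hzt)
  subst hts
  apply hys
  have h1 := convexHull_subset_affineSpan _ hzt
  have h2 := convexHull_subset_affineSpan _ hxs
  have : y = AffineMap.lineMap x (AffineMap.lineMap x y e) e⁻¹ := by
    rw [AffineMap.lineMap_lineMap_right, inv_mul_cancel₀ he2.ne', AffineMap.lineMap_apply_one]
  rw [this]
  exact AffineMap.lineMap_mem _ h2 h1

lemma affineSpan_eq_top_of_card {s : Finset (ι → ℝ)} (h : AffineIndependent ℝ ((↑) : s → ι → ℝ))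
    (hs : s.card = Fintype.card ι + 1) : affineSpan ℝ (s : Set (ι → ℝ)) = ⊤ := by
  have := (h.affineSpan_eq_top_iff_card_eq_finrank_add_one).2
    (by rw [Fintype.card_coe, hs, Module.finrank_pi])
  simpa using this

/-- The dual graph of a triangulation of a full-dimensional convex set is connected. -/
lemma IsTriangulation.mem_of_adj_closed (hK : IsTriangulation K P) (hP : Convex ℝ P)
    (hint : (interior P).Nonempty) {C : Set (Finset (ι → ℝ))}
    (hadj : ∀ s t, IsFacet K s → IsFacet K t → (s \ t).card = 1 → (t \ s).card = 1 →
      s ∈ C → t ∈ C) {s₀ t₀ : Finset (ι → ℝ)} (hs₀ : IsFacet K s₀) (ht₀ : IsFacet K t₀)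
    (hs₀C : s₀ ∈ C) : t₀ ∈ C := by
  have hcard := fun s hs => hK.card_facet hP hint (s := s) hs
  obtain ⟨hf, hC, hcov⟩ := isTriangulation_iff.1 hK
  by_contra ht₀C
  obtain ⟨w, hw, hpos, hw1⟩ := exists_pos_weight (hC.nonempty s₀ hs₀.prop)
  set x := ∑ v ∈ s₀, w v • v with hx
  have hxs : x ∈ convexHull ℝ (s₀ : Set (ι → ℝ)) := mem_convexHull_iff_weight.2 ⟨w, hw, hw1, rfl⟩
  -- A generic target: for a face `r` of codimension at least two, `x` and `r` together have at most
  -- `Fintype.card ι` points, so they span a null set, whereas the hull of `t₀` has interior. The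
  -- segment from `x` to such a `y` meets no such `r` after its start.
  obtain ⟨y, hyt, hy⟩ : ∃ y ∈ convexHull ℝ (t₀ : Set (ι → ℝ)), ∀ r ∈ K, r.card < Fintype.card ι →
      y ∉ affineSpan ℝ ((insert x r : Finset (ι → ℝ)) : Set (ι → ℝ)) := by
    by_contra! hall
    have hnull : MeasureTheory.volume (⋃ r ∈ {r ∈ K | r.card < Fintype.card ι},
        (affineSpan ℝ ((insert x r : Finset (ι → ℝ)) : Set (ι → ℝ)) : Set (ι → ℝ))) = 0 := by
      refine (MeasureTheory.measure_biUnion_null_iff (hf.sep _).countable).2 fun r hr => ?_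
      refine MeasureTheory.Measure.addHaar_affineSubspace _ _ (affineSpan_ne_top_of_card_le ?_)
      exact (Finset.card_insert_le _ _).trans hr.2
    have hne : (interior (convexHull ℝ (t₀ : Set (ι → ℝ)))).Nonempty :=
      interior_convexHull_nonempty_iff_affineSpan_eq_top.2
        (affineSpan_eq_top_of_card (hC.unique.affineIndependent ht₀.prop) (hcard t₀ ht₀))
    refine (isOpen_interior.measure_pos MeasureTheory.volume hne).ne'
      (MeasureTheory.measure_mono_null (fun y hy => ?_) hnull)
    obtain ⟨r, hr, hc, hyr⟩ := hall y (interior_subset hy)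
    exact Set.mem_biUnion (⟨hr, hc⟩ : r ∈ {r ∈ K | r.card < Fintype.card ι}) hyr
  have hxP : x ∈ P := (hcov x).2 ⟨s₀, hs₀.prop, hxs⟩
  have hyP : y ∈ P := (hcov y).2 ⟨t₀, ht₀.prop, hyt⟩
  have hcl : ∀ D : Set (Finset (ι → ℝ)), IsClosed ((fun e : ℝ => AffineMap.lineMap x y e) ⁻¹'
      ⋃ s ∈ {s | s ∈ K ∧ IsFacet K s ∧ s ∈ D}, convexHull ℝ (s : Set (ι → ℝ))) := fun D =>
    ((hf.sep _).isClosed_biUnion fun t _ => isClosed_convexHull_finset t).preimage (by fun_prop)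
  -- The facets in `C` and those outside it cover the segment by two nonempty closed sets, which
  -- meet because an interval is connected.
  obtain ⟨e, he, heC, heC'⟩ := isPreconnected_closed_iff.1
    (isPreconnected_Icc (a := (0 : ℝ)) (b := 1)) _ _ (hcl C) (hcl Cᶜ) (by
      intro e he
      obtain ⟨s, hs, hxs⟩ := (hcov _).1 (hP.lineMap_mem hxP hyP he)
      obtain ⟨t, ht, hst⟩ := exists_isFacet_superset hf hs
      have hxt := convexHull_mono (Finset.coe_subset.2 hst) hxs
      by_cases htC : t ∈ C
      · exact Or.inl (Set.mem_biUnion (show t ∈ {s | s ∈ K ∧ IsFacet K s ∧ s ∈ C} from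
          ⟨ht.prop, ht, htC⟩) hxt)
      · exact Or.inr (Set.mem_biUnion (show t ∈ {s | s ∈ K ∧ IsFacet K s ∧ s ∈ Cᶜ} from
          ⟨ht.prop, ht, htC⟩) hxt))
    ⟨0, by simp, Set.mem_biUnion (show s₀ ∈ {s | s ∈ K ∧ IsFacet K s ∧ s ∈ C} from
      ⟨hs₀.prop, hs₀, hs₀C⟩) (by simpa using hxs)⟩
    ⟨1, by simp, Set.mem_biUnion (show t₀ ∈ {s | s ∈ K ∧ IsFacet K s ∧ s ∈ Cᶜ} from
      ⟨ht₀.prop, ht₀, ht₀C⟩) (by simpa using hyt)⟩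
  simp only [Set.mem_preimage, Set.mem_iUnion, Set.mem_ofPred_eq, exists_prop] at heC heC'
  obtain ⟨s, ⟨hsK, hs, hsC⟩, hzs⟩ := heC
  obtain ⟨t, ⟨htK, ht, htC⟩, hzt⟩ := heC'
  have hz := hC.toSimplicialComplex.inter_subset_convexHull hsK htK ⟨hzs, hzt⟩
  rw [← Finset.coe_inter] at hz
  have hrK : s ∩ t ∈ K := hC.down s hsK _ Finset.inter_subset_left
    (Finset.coe_nonempty.1 (convexHull_nonempty_iff.1 ⟨_, hz⟩))
  have hst : s ≠ t := fun h => htC (h ▸ hsC)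
  have h1 := Finset.card_sdiff_add_card_inter s t
  have h2 := Finset.card_sdiff_add_card_inter t s
  rw [Finset.inter_comm] at h2
  rw [hcard s hs] at h1
  rw [hcard t ht] at h2
  have h3 : (s \ t).card ≠ 0 := by
    rw [Finset.card_ne_zero, Finset.sdiff_nonempty]
    exact fun h => hst (hs.eq_of_le htK h)
  -- The two facets met here are distinct and not adjacent, so they differ in at least two vertices
  -- and `s ∩ t` has codimension at least two.
  have h4 : (s \ t).card ≠ 1 := fun h => htC (hadj s t hs ht h (by omega) hsC)
  -- At the start of the segment genericity of `y` says nothing; there the barycenter of `s₀` would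
  -- lie in a face with fewer vertices.
  rcases he.1.eq_or_lt with rfl | hepos
  · rw [AffineMap.lineMap_apply_zero] at hz
    have := Finset.card_le_card (hC.subset_of_pos hs₀.prop hrK hw hpos hw1 hz)
    rw [hcard s₀ hs₀] at this
    omega
  · refine hy (s ∩ t) hrK (by omega) ?_
    have h1 := affineSpan_mono ℝ (Finset.coe_subset.2 (Finset.subset_insert x (s ∩ t)))
      (convexHull_subset_affineSpan _ hz)
    have h2 := subset_affineSpan ℝ _ (Finset.mem_coe.2 (Finset.mem_insert_self x (s ∩ t)))
    have : y = AffineMap.lineMap x (AffineMap.lineMap x y e) e⁻¹ := by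
      rw [AffineMap.lineMap_lineMap_right, inv_mul_cancel₀ hepos.ne', AffineMap.lineMap_apply_one]
    rw [this]
    exact AffineMap.lineMap_mem _ h2 h1

end FullDimensional

/-! ### Volumes of simplices -/

section Volume

open MeasureTheory

/-- Slicing at first coordinate `a` leaves a corner of size `t - a` one dimension lower; this is why
the size must vary in the induction. -/
lemma volume_fin_corner (d : ℕ) : ∀ t : ℝ, 0 ≤ t →
    volume {x : Fin d → ℝ | (∀ i, 0 ≤ x i) ∧ ∑ i, x i ≤ t} =
      ENNReal.ofReal (t ^ d / d.factorial) := by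
  induction d with
  | zero =>
    intro t ht
    have : {x : Fin 0 → ℝ | (∀ i, 0 ≤ x i) ∧ ∑ i, x i ≤ t} = Set.univ := by
      ext x
      simp [ht]
    rw [this]
    simp [volume_pi]
  | succ d ih =>
    intro t ht
    let S : Set (ℝ × (Fin d → ℝ)) := {y | 0 ≤ y.1 ∧ (∀ i, 0 ≤ y.2 i) ∧ y.1 + ∑ i, y.2 i ≤ t}
    have hS : MeasurableSet S := by
      refine IsClosed.measurableSet ?_
      simp only [S, Set.ofPred_and, Set.ofPred_forall]
      exact (isClosed_le (by fun_prop) (by fun_prop)).inter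
        ((isClosed_iInter fun i => isClosed_le (by fun_prop) (by fun_prop)).inter
          (isClosed_le (by fun_prop) (by fun_prop)))
    have hpre : {x : Fin (d + 1) → ℝ | (∀ i, 0 ≤ x i) ∧ ∑ i, x i ≤ t} =
        MeasurableEquiv.piFinSuccAbove (fun _ => ℝ) 0 ⁻¹' S := by
      ext x
      simp [S, Fin.forall_fin_succ, Fin.sum_univ_succ, Fin.tail, and_assoc]
    rw [hpre, (volume_preserving_piFinSuccAbove (fun _ => ℝ) 0).measure_preimage
      hS.nullMeasurableSet, Measure.volume_eq_prod, Measure.prod_apply hS]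
    have hslice : ∀ a : ℝ, volume (Prod.mk a ⁻¹' S) =
        (Set.Icc 0 t).indicator (fun a => ENNReal.ofReal ((t - a) ^ d / d.factorial)) a := by
      intro a
      by_cases ha : a ∈ Set.Icc 0 t
      · rw [Set.indicator_of_mem ha, ← ih (t - a) (sub_nonneg.2 ha.2)]
        congr 1
        ext y
        simp [S, ha.1, le_sub_iff_add_le']
      · rw [Set.indicator_of_notMem ha]
        convert! measure_empty (μ := volume)
        rw [Set.eq_empty_iff_forall_notMem]
        rintro y ⟨h1, h2, h3⟩
        exact ha ⟨h1, by
          have := Finset.sum_nonneg fun i (_ : i ∈ Finset.univ) => h2 i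
          dsimp only at h3 this ⊢
          linarith⟩
    simp_rw [hslice]
    rw [lintegral_indicator measurableSet_Icc, ← ofReal_integral_eq_lintegral_ofReal]
    · congr 1
      rw [integral_Icc_eq_integral_Ioc, ← intervalIntegral.integral_of_le ht,
        intervalIntegral.integral_div, intervalIntegral.integral_comp_sub_left (fun x => x ^ d) t,
        sub_self, sub_zero, integral_pow, Nat.factorial_succ]
      push_cast
      field_simp
      simp
    · exact (Continuous.continuousOn (by fun_prop)).integrableOn_compact isCompact_Icc
    · refine (ae_restrict_mem measurableSet_Icc).mono fun a ha => ?_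
      have := sub_nonneg.2 ha.2
      positivity

lemma volume_corner (ι : Type*) [Fintype ι] :
    volume {x : ι → ℝ | (∀ i, 0 ≤ x i) ∧ ∑ i, x i ≤ 1} =
      ENNReal.ofReal (1 / (Fintype.card ι).factorial) := by
  have h := volume_fin_corner (Fintype.card ι) 1 zero_le_one
  rw [one_pow] at h
  rw [← h, ← (volume_measurePreserving_piCongrLeft (fun _ => ℝ)
    (Fintype.equivFin ι)).measure_preimage_equiv]
  congr 1
  ext x
  have hx : ∀ i, MeasurableEquiv.piCongrLeft (fun _ => ℝ) (Fintype.equivFin ι) x i =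
      x ((Fintype.equivFin ι).symm i) := fun i => by
    obtain ⟨k, rfl⟩ := (Fintype.equivFin ι).surjective i
    rw [MeasurableEquiv.coe_piCongrLeft, Equiv.piCongrLeft_apply_apply, Equiv.symm_apply_apply]
  simp only [Set.mem_preimage, Set.mem_ofPred_eq, hx]
  rw [Equiv.sum_comp (Fintype.equivFin ι).symm x, Equiv.forall_congr_left (Fintype.equivFin ι)]

end Volume

/-! ### Edge matrices -/

section EdgeMatrix

variable {ι : Type*} {d : ℕ}

/-- The matrix whose rows are the edge vectors at the zeroth vertex of a simplex. -/
def edgeMatrix (e : ι ≃ Fin d) (p : Fin (d + 1) → ι → ℝ) : Matrix ι ι ℝ :=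
  Matrix.of fun i j => p (e i).succ j - p 0 j

variable [Fintype ι] (e : ι ≃ Fin d) (p : Fin (d + 1) → ι → ℝ)

/-- The determinant of the edge vectors at the zeroth vertex of a simplex. -/
def edgeDet : ℝ := (edgeMatrix e p).det

lemma vecMul_edgeMatrix (u : ι → ℝ) :
    Matrix.vecMul u (edgeMatrix e p) = ∑ i, u i • (p (e i).succ - p 0) := by
  ext j
  simp [Matrix.vecMul, dotProduct, edgeMatrix]

lemma sum_smul_eq_vecMul_edgeMatrix (u : Fin (d + 1) → ℝ) :
    ∑ i, u i • p i =
      Matrix.vecMul (fun i => u (e i).succ) (edgeMatrix e p) + (∑ i, u i) • p 0 := by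
  rw [vecMul_edgeMatrix, e.sum_comp fun i => u i.succ • (p i.succ - p 0), Fin.sum_univ_succ,
    Fin.sum_univ_succ]
  simp_rw [smul_sub]
  rw [Finset.sum_sub_distrib, add_smul, Finset.sum_smul]
  abel

/-- Dropping the barycentric coordinate of the zeroth vertex exhibits the simplex as an affine image
of the standard corner, with linear part `edgeMatrix`; its volume is then a determinant. -/
lemma convexHull_range_eq_image :
    convexHull ℝ (Set.range p) = (fun x => x + p 0) ''
      ((edgeMatrix e p).vecMulLinear '' {x : ι → ℝ | (∀ i, 0 ≤ x i) ∧ ∑ i, x i ≤ 1}) := by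
  rw [Set.image_image]
  ext x
  have hrange : x ∈ convexHull ℝ (Set.range p) ↔
      ∃ w : Fin (d + 1) → ℝ, (∀ i, 0 ≤ w i) ∧ ∑ i, w i = 1 ∧ ∑ i, w i • p i = x := by
    constructor
    · intro hx
      rw [convexHull_range_eq_exists_affineCombination] at hx
      obtain ⟨s, w, h0, h1, hx⟩ := hx
      refine ⟨fun i => if i ∈ s then w i else 0, fun i => ?_, ?_, ?_⟩
      · dsimp only
        split_ifs with hi
        exacts [h0 i hi, le_rfl]
      · rw [← h1]
        simp
      · rw [Finset.affineCombination_eq_linear_combination _ _ _ h1] at hx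
        rw [← hx]
        simp
    · rintro ⟨w, h0, h1, hx⟩
      exact mem_convexHull_of_exists_fintype w p h0 h1 (fun i => ⟨i, rfl⟩) hx
  rw [hrange]
  constructor
  · rintro ⟨w, h0, h1, hx⟩
    refine ⟨fun i => w (e i).succ, ⟨fun i => h0 _, ?_⟩, ?_⟩
    · rw [e.sum_comp fun i => w i.succ, ← h1, Fin.sum_univ_succ]
      linarith [h0 0]
    · rw [← hx, sum_smul_eq_vecMul_edgeMatrix e, h1, one_smul]
      rfl
  · rintro ⟨u, ⟨h0, h1⟩, hx⟩
    refine ⟨Fin.cons (1 - ∑ i, u i) fun i => u (e.symm i), ?_, ?_, ?_⟩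
    · intro i
      refine Fin.cases ?_ (fun i => ?_) i
      · simpa using h1
      · simpa using h0 _
    · rw [Fin.sum_univ_succ]
      simp [e.symm.sum_comp u]
    · rw [sum_smul_eq_vecMul_edgeMatrix e, Fin.sum_univ_succ]
      simp [e.symm.sum_comp u, ← hx]

lemma normalizedVolume_convexHull :
    normalizedVolume (convexHull ℝ (Set.range p)) = |edgeDet e p| := by
  rw [normalizedVolume, convexHull_range_eq_image e, Set.image_add_right,
    MeasureTheory.measure_preimage_add_right, MeasureTheory.Measure.addHaar_image_linearMap,
    volume_corner, ENNReal.toReal_mul, ENNReal.toReal_ofReal (abs_nonneg _),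
    ENNReal.toReal_ofReal (by positivity)]
  have : LinearMap.det (edgeMatrix e p).vecMulLinear = edgeDet e p := by
    rw [edgeDet, ← Matrix.det_transpose, ← LinearMap.det_toLin', Matrix.toLin'_apply']
    congr 1
    ext x
    simp
  rw [this]
  have := Nat.factorial_ne_zero (Fintype.card ι)
  field_simp

lemma edgeDet_isInt (hp : ∀ i, p i ∈ latticePoints ι) :
    ∃ k : ℤ, edgeDet e p = k := by
  choose z hz using hp
  refine ⟨(Matrix.of fun i j => z (e i).succ j - z 0 j).det, ?_⟩
  rw [edgeDet, Int.cast_det]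
  congr 1
  ext i j
  simp [edgeMatrix, ← hz]

lemma edgeDet_ne_zero (hp : AffineIndependent ℝ p) : edgeDet e p ≠ 0 := by
  have h1 := (affineIndependent_iff_linearIndependent_vsub ℝ p 0).1 hp
  have h2 : LinearIndependent ℝ (edgeMatrix e p).row :=
    h1.comp (fun i : ι => (⟨(e i).succ, Fin.succ_ne_zero _⟩ : {x : Fin (d + 1) // x ≠ 0}))
      fun i j hij => e.injective (Fin.succ_injective _ (congrArg Subtype.val hij))
  exact ((Matrix.isUnit_iff_isUnit_det _).1
    (Matrix.linearIndependent_rows_iff_isUnit.1 h2)).ne_zero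

/-- The effect on the determinant of replacing one vertex of a simplex. -/
lemma edgeDet_update (a : Fin (d + 1) → ℝ) (ha : ∑ i, a i = 1) (j : Fin (d + 1)) :
    edgeDet e (Function.update p j (∑ i, a i • p i)) =
      a j * edgeDet e p := by
  have hv := sum_smul_eq_vecMul_edgeMatrix e p a
  rw [ha, one_smul] at hv
  rw [hv]
  refine Fin.cases ?_ (fun k => ?_) j
  -- Moving the base vertex shifts every row by the same vector, a rank-one perturbation. The matrix
  -- determinant lemma yields the factor one minus the other coefficients, which is `a 0`.
  · have hm : edgeMatrix e (Function.update p 0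
        (Matrix.vecMul (fun i => a (e i).succ) (edgeMatrix e p) + p 0)) =
        (1 + Matrix.replicateCol Unit (fun _ => (1 : ℝ)) *
          Matrix.replicateRow Unit (fun i => -a (e i).succ)) * edgeMatrix e p := by
      ext i j
      rw [add_mul, one_mul, Matrix.mul_assoc, Matrix.add_apply, Matrix.mul_apply]
      simp only [edgeMatrix, Matrix.of_apply, Function.update_self, Pi.add_apply,
        Function.update_of_ne (Fin.succ_ne_zero _)]
      simp [Matrix.mul_apply, Matrix.vecMul, dotProduct]
      ring
    rw [edgeDet, edgeDet, hm, Matrix.det_mul, Matrix.det_one_add_replicateCol_mul_replicateRow]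
    congr 1
    rw [Fin.sum_univ_succ] at ha
    simp only [dotProduct, mul_one, Finset.sum_neg_distrib]
    rw [e.sum_comp fun i => a i.succ]
    linarith
  · have hm : edgeMatrix e (Function.update p k.succ
        (Matrix.vecMul (fun i => a (e i).succ) (edgeMatrix e p) + p 0)) =
        (edgeMatrix e p).updateRow (e.symm k) (∑ i, a (e i).succ • edgeMatrix e p i) := by
      ext i j
      have hz : Function.update p k.succ
        (Matrix.vecMul (fun i => a (e i).succ) (edgeMatrix e p) + p 0) 0 = p 0 :=
          Function.update_of_ne (Fin.succ_ne_zero _).symm _ _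
      by_cases hi : i = e.symm k
      · subst hi
        rw [Matrix.updateRow_self, edgeMatrix, Matrix.of_apply, hz, Equiv.apply_symm_apply,
          Function.update_self]
        simp [Matrix.vecMul, dotProduct, edgeMatrix]
      · rw [Matrix.updateRow_ne hi, edgeMatrix, Matrix.of_apply, hz, Function.update_of_ne]
        · rfl
        · exact fun h => hi (by rw [← Fin.succ_injective _ h, Equiv.symm_apply_apply])
    rw [edgeDet, edgeDet, hm, Matrix.det_updateRow_sum (edgeMatrix e p) (e.symm k) fun i => a (e i).succ]
    simp

/-- Every point has affine coordinates with respect to a non-degenerate simplex. -/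
lemma exists_affine_coordinates (h : edgeDet e p ≠ 0) (x : ι → ℝ) :
    ∃ a : Fin (d + 1) → ℝ, ∑ i, a i = 1 ∧ ∑ i, a i • p i = x := by
  let u := Matrix.vecMul (x - p 0) (edgeMatrix e p)⁻¹
  refine ⟨Fin.cons (1 - ∑ i, u i) fun i => u (e.symm i), ?_, ?_⟩
  · rw [Fin.sum_univ_succ]
    simp [e.symm.sum_comp u]
  · rw [sum_smul_eq_vecMul_edgeMatrix e, Fin.sum_univ_succ]
    simp [e.symm.sum_comp u]
    simp [u, Matrix.vecMul_vecMul, Matrix.nonsing_inv_mul _ (isUnit_iff_ne_zero.2 h)]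

end EdgeMatrix

/-! ### The signature as a sum of signs of determinants -/

section Signature

/-- The sign of an odd integer, and zero for all other numbers. -/
def oddSign (x : ℝ) : ℤ := if ∃ k : ℤ, Odd k ∧ x = k then (if 0 < x then 1 else -1) else 0

lemma oddSign_intCast (k : ℤ) : oddSign k = if Odd k then (if 0 < k then 1 else -1) else 0 := by
  simp [oddSign]

/-- A product of integers is odd exactly when both factors are, so discarding the even facets is
compatible with multiplying determinants. -/
lemma oddSign_mul (a b : ℤ) : oddSign ((a : ℝ) * b) = oddSign a * oddSign b := by
  rw [← Int.cast_mul, oddSign_intCast, oddSign_intCast, oddSign_intCast]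
  simp only [Int.odd_mul]
  by_cases ha : Odd a
  · by_cases hb : Odd b
    · have ha0 : a ≠ 0 := by rintro rfl; simp at ha
      have hb0 : b ≠ 0 := by rintro rfl; simp at hb
      simp only [ha, hb, and_self, if_true]
      rcases lt_or_gt_of_ne ha0 with h1 | h1 <;> rcases lt_or_gt_of_ne hb0 with h2 | h2
      · simp [mul_pos_of_neg_of_neg h1 h2, h1.not_gt, h2.not_gt]
      · simp [(mul_neg_of_neg_of_pos h1 h2).not_gt, h1.not_gt, h2]
      · simp [(mul_neg_of_pos_of_neg h1 h2).not_gt, h1, h2.not_gt]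
      · simp [mul_pos h1 h2, h1, h2]
    · simp [hb]
  · simp [ha]

/-- A triangulation of a full-dimensional convex set with lattice vertices and a coloring. -/
structure IsColoredTriangulation {ι : Type*} [Fintype ι] (d : ℕ) (K : Set (Finset (ι → ℝ)))
    (P : Set (ι → ℝ)) (c : (ι → ℝ) → Fin (d + 1)) : Prop where
  triangulation : IsTriangulation K P
  convex : Convex ℝ P
  interior_nonempty : (interior P).Nonempty
  lattice : vertices K ⊆ latticePoints ι
  coloring : IsColoring d K c

/-- The set of values of a finite family. -/
def valueFinset {E : Type*} {k : ℕ} (p : Fin k → E) : Finset E := Finset.univ.image p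

section ValueFinset

variable {E : Type*} {k : ℕ} {p : Fin k → E}

lemma mem_valueFinset {v : E} : v ∈ valueFinset p ↔ ∃ i, p i = v := by simp [valueFinset]

lemma apply_mem_valueFinset (p : Fin k → E) (i : Fin k) : p i ∈ valueFinset p :=
  mem_valueFinset.2 ⟨i, rfl⟩

lemma coe_valueFinset : (valueFinset p : Set E) = Set.range p := by simp [valueFinset]

lemma card_valueFinset (hp : Function.Injective p) : (valueFinset p).card = k := by
  rw [valueFinset, Finset.card_image_of_injective _ hp, Finset.card_univ, Fintype.card_fin]

lemma sum_valueFinset {M : Type*} [AddCommMonoid M] (hp : Function.Injective p) (f : E → M) :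
    ∑ v ∈ valueFinset p, f v = ∑ i, f (p i) :=
  Finset.sum_image hp.injOn

end ValueFinset

/-- The facets of a colored complex, enumerated by their colors. -/
def coloredFacets {E : Type*} {d : ℕ} (K : Set (Finset E)) (c : E → Fin (d + 1)) :
    Set (Fin (d + 1) → E) :=
  {p | valueFinset p ∈ K ∧ ∀ i, c (p i) = i}

lemma coloredFacets_injOn {E : Type*} {d : ℕ} {K : Set (Finset E)} {c : E → Fin (d + 1)}
    {p q : Fin (d + 1) → E} (hp : p ∈ coloredFacets K c) (hq : q ∈ coloredFacets K c)
    (h : valueFinset p = valueFinset q) : p = q := by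
  funext i
  have : p i ∈ valueFinset q := h ▸ apply_mem_valueFinset p i
  obtain ⟨j, hj⟩ := mem_valueFinset.1 this
  have := congrArg c hj
  rw [hq.2, hp.2] at this
  rw [← hj, this]

lemma coloredFacets_injective {E : Type*} {d : ℕ} {K : Set (Finset E)} {c : E → Fin (d + 1)}
    {p : Fin (d + 1) → E} (hp : p ∈ coloredFacets K c) : Function.Injective p := fun i j hij => by
  rw [← hp.2 i, ← hp.2 j, hij]

/-- The signed number of odd facets. -/
def signedCount {ι : Type*} [Fintype ι] {d : ℕ} (e : ι ≃ Fin d) (K : Set (Finset (ι → ℝ)))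
    (c : (ι → ℝ) → Fin (d + 1)) : ℤ :=
  ∑ᶠ p ∈ coloredFacets K c, oddSign (edgeDet e p)

variable {ι : Type*} [Fintype ι] {d : ℕ} {K : Set (Finset (ι → ℝ))}
  {P : Set (ι → ℝ)} {c : (ι → ℝ) → Fin (d + 1)}

namespace IsColoredTriangulation

lemma isComplex (h : IsColoredTriangulation d K P c) : IsComplex K :=
  (isTriangulation_iff.1 h.triangulation).2.1

lemma finite (h : IsColoredTriangulation d K P c) : K.Finite := h.triangulation.1

lemma card_facet (h : IsColoredTriangulation d K P c) (e : ι ≃ Fin d) {s : Finset (ι → ℝ)}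
    (hs : IsFacet K s) : s.card = d + 1 := by
  rw [h.triangulation.card_facet h.convex h.interior_nonempty hs, Fintype.card_congr e,
    Fintype.card_fin]

/-- A face with `d + 1` vertices cannot grow, since affinely independent sets in dimension `d` have
no more points. -/
lemma isFacet_of_mem_coloredFacets (h : IsColoredTriangulation d K P c) (e : ι ≃ Fin d)
    {p : Fin (d + 1) → ι → ℝ} (hp : p ∈ coloredFacets K c) :
    IsFacet K (valueFinset p) := by
  refine ⟨hp.1, fun t ht hpt => (Finset.eq_of_subset_of_card_le hpt ?_).ge⟩
  rw [card_valueFinset (coloredFacets_injective hp)]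
  have := h.isComplex.card_le ht
  rwa [Fintype.card_congr e, Fintype.card_fin] at this

/-- By purity a facet has as many vertices as there are colors, so every color occurs exactly once.
-/
lemma exists_coloredFacet (h : IsColoredTriangulation d K P c) (e : ι ≃ Fin d)
    {s : Finset (ι → ℝ)} (hs : IsFacet K s) :
    ∃ p ∈ coloredFacets K c, valueFinset p = s := by
  have himg : s.image c = Finset.univ := by
    rw [← Finset.card_eq_iff_eq_univ, Finset.card_image_of_injOn (h.coloring s hs.prop),
      h.card_facet e hs, Fintype.card_fin]
  have hex : ∀ i, ∃ v ∈ s, c v = i := fun i =>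
    Finset.mem_image.1 (himg ▸ Finset.mem_univ i)
  choose p hps hpc using hex
  have hps' : valueFinset p = s := by
    refine Finset.eq_of_subset_of_card_le (fun v hv => ?_) ?_
    · obtain ⟨i, rfl⟩ := mem_valueFinset.1 hv
      exact hps i
    rw [h.card_facet e hs, card_valueFinset]
    intro i j hij
    rw [← hpc i, ← hpc j, hij]
  exact ⟨p, ⟨by rw [hps']; exact hs.prop, hpc⟩, hps'⟩

lemma finite_coloredFacets (h : IsColoredTriangulation d K P c) :
    (coloredFacets K c).Finite :=
  Set.Finite.of_finite_image (f := valueFinset)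
    (h.finite.subset (Set.image_subset_iff.2 fun _ hp => hp.1))
    fun _ hp _ hq hpq => coloredFacets_injOn hp hq hpq

lemma det_ne_zero (h : IsColoredTriangulation d K P c) (e : ι ≃ Fin d)
    {p : Fin (d + 1) → ι → ℝ} (hp : p ∈ coloredFacets K c) : edgeDet e p ≠ 0 := by
  refine edgeDet_ne_zero e p ?_
  have h1 := h.isComplex.unique.affineIndependent hp.1
  let f : Fin (d + 1) ↪ valueFinset p :=
    ⟨fun i => ⟨p i, apply_mem_valueFinset p i⟩,
      fun i j hij => coloredFacets_injective hp (congrArg Subtype.val hij)⟩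
  exact h1.comp_embedding f

lemma det_isInt (h : IsColoredTriangulation d K P c) (e : ι ≃ Fin d)
    {p : Fin (d + 1) → ι → ℝ} (hp : p ∈ coloredFacets K c) :
    ∃ k : ℤ, edgeDet e p = k :=
  edgeDet_isInt e p fun i => h.lattice
    (h.isComplex.mem_vertices hp.1 (apply_mem_valueFinset p i))

lemma isOddSimplex_iff (e : ι ≃ Fin d) {p : Fin (d + 1) → ι → ℝ} :
    IsOddSimplex (valueFinset p) ↔ ∃ k : ℤ, Odd k ∧ (edgeDet e p) = k := by
  rw [IsOddSimplex, coe_valueFinset,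
    normalizedVolume_convexHull e p]
  constructor
  · rintro ⟨k, hk, h⟩
    rcases abs_choice (edgeDet e p) with h1 | h1
    · exact ⟨k, by exact_mod_cast hk, by rw [← h1, h]; simp⟩
    · refine ⟨-k, Odd.neg (by exact_mod_cast hk), ?_⟩
      rw [h1] at h
      push_cast
      linarith
  · rintro ⟨k, hk, h⟩
    exact ⟨k.natAbs, Int.natAbs_odd.2 hk, by rw [h, Nat.cast_natAbs, Int.cast_abs]⟩

/-- Facets that differ in one vertex have opposite orientations. -/
lemma det_mul_neg_of_adj (h : IsColoredTriangulation d K P c) (e : ι ≃ Fin d)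
    {p q : Fin (d + 1) → ι → ℝ} (hp : p ∈ coloredFacets K c) (hq : q ∈ coloredFacets K c)
    (hpq : (valueFinset p \ valueFinset q).card = 1) :
    edgeDet e p * edgeDet e q < 0 := by
  obtain ⟨u, hu⟩ := Finset.card_eq_one.1 hpq
  have humem : u ∈ valueFinset p \ valueFinset q := hu ▸ Finset.mem_singleton_self u
  obtain ⟨hup, huq⟩ := Finset.mem_sdiff.1 humem
  obtain ⟨j, rfl⟩ := mem_valueFinset.1 hup
  have hne : ∀ i, i ≠ j → q i = p i := by
    intro i hij
    have hmem : p i ∈ valueFinset q := by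
      by_contra hcon
      have : p i ∈ valueFinset p \ valueFinset q :=
        Finset.mem_sdiff.2 ⟨apply_mem_valueFinset p i, hcon⟩
      rw [hu, Finset.mem_singleton] at this
      exact hij (coloredFacets_injective hp this)
    obtain ⟨k, hk⟩ := mem_valueFinset.1 hmem
    have := congrArg c hk
    rw [hq.2, hp.2] at this
    rw [← hk, this]
  have hqj : ∀ i, p i ≠ q j := by
    intro i hi
    have := congrArg c hi
    rw [hp.2, hq.2] at this
    subst this
    exact huq (hi ▸ apply_mem_valueFinset q i)
  have hdet := h.det_ne_zero e hp
  obtain ⟨a, ha1, hax⟩ := exists_affine_coordinates e p hdet (q j)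
  have hqup : q = Function.update p j (∑ i, a i • p i) := by
    rw [hax]
    funext i
    by_cases hi : i = j
    · subst hi
      rw [Function.update_self]
    · rw [Function.update_of_ne hi, hne i hi]
  -- If `a j` were nonnegative, adding a large `N` to the coefficients of the common vertices would
  -- write `q j + N * ∑ (common vertices)` with nonnegative weights on both facets. Uniqueness of
  -- weights fails at `q j`, which has weight 1 on one side and 0 on the other.
  have haj : a j < 0 := by
    by_contra! hcon
    obtain ⟨N, hN⟩ : ∃ N : ℝ, ∀ i, 0 ≤ a i + N ∧ 0 ≤ N := by
      refine ⟨∑ i, |a i|, fun i => ⟨?_, Finset.sum_nonneg fun i _ => abs_nonneg _⟩⟩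
      have := Finset.single_le_sum (fun i _ => abs_nonneg (a i)) (Finset.mem_univ i)
      linarith [neg_abs_le (a i)]
    let b : Fin (d + 1) → ℝ := fun i => if i = j then a j else a i + N
    let b' : Fin (d + 1) → ℝ := fun i => if i = j then 1 else N
    have hext : ∀ (r : Fin (d + 1) → ι → ℝ), Function.Injective r → ∀ y : Fin (d + 1) → ℝ,
        (∀ i, 0 ≤ y i) → IsWeight (valueFinset r) (Function.extend r y 0) ∧
          ∑ v ∈ valueFinset r, Function.extend r y 0 v = ∑ i, y i ∧
          ∑ v ∈ valueFinset r, Function.extend r y 0 v • v = ∑ i, y i • r i := by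
      intro r hr y hy
      refine ⟨⟨fun v => ?_, fun v hv => ?_⟩, ?_, ?_⟩
      · by_cases hv : ∃ i, r i = v
        · obtain ⟨i, rfl⟩ := hv
          rw [hr.extend_apply]
          exact hy i
        · rw [Function.extend_apply' _ _ _ hv]
          exact le_rfl
      · rw [Function.extend_apply']
        · rfl
        · rintro ⟨i, rfl⟩
          exact hv (apply_mem_valueFinset r i)
      · rw [sum_valueFinset hr]
        simp_rw [hr.extend_apply]
      · rw [sum_valueFinset hr]
        simp_rw [hr.extend_apply]
    obtain ⟨hw, hw1, hwx⟩ := hext p (coloredFacets_injective hp) b fun i => by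
      simp only [b]
      split_ifs
      exacts [hcon, (hN i).1]
    obtain ⟨hw', hw1', hwx'⟩ := hext q (coloredFacets_injective hq) b' fun i => by
      simp only [b']
      split_ifs
      exacts [zero_le_one, (hN i).2]
    have heq := h.isComplex.unique _ hp.1 _ hq.1 _ _ hw hw' ?_ ?_
    · have := congrFun heq (q j)
      rw [(coloredFacets_injective hq).extend_apply, Function.extend_apply'] at this
      · simp [b'] at this
      · rintro ⟨i, hi⟩
        exact hqj i hi
    · rw [hw1, hw1', ← Finset.add_sum_erase _ _ (Finset.mem_univ j),
        ← Finset.add_sum_erase _ b' (Finset.mem_univ j)]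
      rw [← Finset.add_sum_erase _ _ (Finset.mem_univ j)] at ha1
      have h1 : ∑ i ∈ Finset.univ.erase j, b i =
          ∑ i ∈ Finset.univ.erase j, a i + ∑ i ∈ Finset.univ.erase j, b' i := by
        rw [← Finset.sum_add_distrib]
        refine Finset.sum_congr rfl fun i hi => ?_
        simp [b, b', Finset.ne_of_mem_erase hi]
      rw [h1]
      simp only [b, b', if_true]
      linarith
    · rw [hwx, hwx', ← Finset.add_sum_erase _ _ (Finset.mem_univ j),
        ← Finset.add_sum_erase _ (fun i => b' i • q i) (Finset.mem_univ j)]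
      have h1 : ∑ i ∈ Finset.univ.erase j, b i • p i =
          ∑ i ∈ Finset.univ.erase j, a i • p i + ∑ i ∈ Finset.univ.erase j, b' i • q i := by
        rw [← Finset.sum_add_distrib]
        refine Finset.sum_congr rfl fun i hi => ?_
        simp [b, b', Finset.ne_of_mem_erase hi, hne i (Finset.ne_of_mem_erase hi), add_smul]
      rw [h1]
      simp only [b, b', if_true, one_smul]
      rw [← hax, ← Finset.add_sum_erase _ _ (Finset.mem_univ j)]
      abel
  rw [hqup, edgeDet_update e p a ha1]
  have : 0 < edgeDet e p * edgeDet e p := mul_self_pos.2 hdet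
  nlinarith

lemma ncard_sub_ncard {F : Type*} [Fintype F] (b : F → Bool) (odd : F → Prop) :
    (({f | b f = true ∧ odd f}.ncard : ℕ) : ℤ) - (({f | b f = false ∧ odd f}.ncard : ℕ) : ℤ) =
      ∑ f, if odd f then (if b f then 1 else -1) else 0 := by
  rw [Set.ncard_eq_toFinset_card', Set.ncard_eq_toFinset_card', Set.toFinset_ofPred,
    Set.toFinset_ofPred, Finset.card_filter, Finset.card_filter]
  push_cast
  rw [← Finset.sum_sub_distrib]
  refine Finset.sum_congr rfl fun f _ => ?_
  by_cases h1 : odd f <;> cases h2 : b f <;> simp [h1]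

/-- The signature of a foldable triangulation of a full-dimensional convex set is the absolute
value of its signed number of odd facets. -/
theorem signature_eq (h : IsColoredTriangulation d K P c) (e : ι ≃ Fin d) :
    signature K = (signedCount e K c).natAbs := by
  have hex : ∀ f : {s : Finset (ι → ℝ) // IsFacet K s},
      ∃ p ∈ coloredFacets K c, valueFinset p = f.1 := fun f => h.exists_coloredFacet e f.2
  choose p hp hpf using hex
  -- The reference 2-coloring is the orientation of a facet whose vertices are listed by color.
  let b : (dualGraph K).Coloring Bool := SimpleGraph.Coloring.mk
    (fun f => decide (0 < (edgeDet e (p f)))) (by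
      intro f g hfg heq
      have hneg := h.det_mul_neg_of_adj e (hp f) (hp g) (by
        rw [hpf, hpf]
        convert hfg.1)
      have hiff := decide_eq_decide.1 heq
      rcases (h.det_ne_zero e (hp f)).lt_or_gt with h1 | h1 <;>
        rcases (h.det_ne_zero e (hp g)).lt_or_gt with h2 | h2
      · nlinarith
      · exact h1.not_gt (hiff.2 h2)
      · exact h2.not_gt (hiff.1 h1)
      · nlinarith)
  have : Finite {s : Finset (ι → ℝ) // IsFacet K s} :=
    (h.finite.subset fun s (hs : IsFacet K s) => hs.prop).to_subtype
  have : Fintype {s : Finset (ι → ℝ) // IsFacet K s} := Fintype.ofFinite _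
  have hb : (({f | b f = true ∧ IsOddSimplex f.1}.ncard : ℕ) : ℤ) -
      (({f | b f = false ∧ IsOddSimplex f.1}.ncard : ℕ) : ℤ) = signedCount e K c := by
    rw [ncard_sub_ncard (fun f => b f) fun f => IsOddSimplex f.1, signedCount,
      ← finsum_eq_sum_of_fintype, ← finsum_mem_univ]
    refine finsum_mem_eq_of_bijOn p ⟨fun f _ => hp f, fun f _ g _ hfg => ?_, fun q hq => ?_⟩ ?_
    · exact Subtype.ext (by rw [← hpf f, hfg, hpf g])
    · refine ⟨⟨_, h.isFacet_of_mem_coloredFacets e hq⟩, trivial, ?_⟩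
      exact coloredFacets_injOn (hp _) hq (hpf _)
    · intro f _
      rw [oddSign, ← isOddSimplex_iff e, hpf]
      by_cases hodd : IsOddSimplex f.1
      · rw [if_pos hodd, if_pos hodd]
        change (if decide (0 < (edgeDet e (p f))) = true then (1 : ℤ) else -1) = _
        simp only [decide_eq_true_eq]
      · rw [if_neg hodd, if_neg hodd]
  rw [signature, dif_pos ⟨b⟩]
  generalize Nonempty.some _ = b'
  -- `signature` uses an arbitrary 2-coloring `b'`. Agreement with `b` passes along edges, so by
  -- connectedness `b'` is `b` or its negation, and the negation only changes the sign of the count.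
  have hadj : ∀ f g, (dualGraph K).Adj f g → (b' f = b f ↔ b' g = b g) := by
    intro f g hfg
    have h1 := b.valid hfg
    have h2 := b'.valid hfg
    revert h1 h2
    cases b f <;> cases b g <;> cases b' f <;> cases b' g <;> simp
  by_cases hex : ∃ f, b' f = b f
  · obtain ⟨f₀, hf₀⟩ := hex
    have hall : ∀ g, b' g = b g := by
      intro g
      refine h.triangulation.mem_of_adj_closed h.convex h.interior_nonempty
        (C := {s | ∀ hs : IsFacet K s, b' ⟨s, hs⟩ = b ⟨s, hs⟩}) ?_ f₀.2 g.2 (fun _ => hf₀) g.2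
      intro s t hs ht h1 h2 hC ht'
      refine (hadj ⟨s, hs⟩ ⟨t, ht⟩ ⟨?_, ?_⟩).1 (hC hs)
      · convert h1
      · convert h2
    rw [colorDifference, ← hb]
    simp_rw [hall]
  · push Not at hex
    have hall : ∀ g, b' g = !b g := fun g => Bool.eq_not.2 (hex g)
    rw [colorDifference, ← hb, ← Int.natAbs_neg, neg_sub]
    simp_rw [hall, Bool.not_eq_true', Bool.not_eq_false']

end IsColoredTriangulation

end Signature

/-! ### Monotone couplings -/

section Coupling

/-- There is a coupling of the weights `a` and `b` with totally ordered support. -/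
def HasMonotoneCoupling {X Y : Type*} (α : X → ℕ) (β : Y → ℕ) (F : Finset X) (G : Finset Y)
    (a : X → ℝ) (b : Y → ℝ) : Prop :=
  ∃ w : X → Y → ℝ, (∀ x y, 0 ≤ w x y) ∧ (∀ x y, w x y ≠ 0 → x ∈ F ∧ y ∈ G) ∧
    (∀ x, ∑ y ∈ G, w x y = a x) ∧ (∀ y, ∑ x ∈ F, w x y = b y) ∧
    ∀ x y x' y', w x y ≠ 0 → w x' y' ≠ 0 →
      (α x ≤ α x' ∧ β y ≤ β y') ∨ (α x' ≤ α x ∧ β y' ≤ β y)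

variable {X Y : Type*} {α : X → ℕ} {β : Y → ℕ} {F : Finset X} {G : Finset Y}
  {a : X → ℝ} {b : Y → ℝ}

lemma HasMonotoneCoupling.swap (h : HasMonotoneCoupling α β F G a b) :
    HasMonotoneCoupling β α G F b a := by
  obtain ⟨w, h0, hs, ha, hb, hc⟩ := h
  refine ⟨fun y x => w x y, fun y x => h0 x y, fun y x hxy => (hs x y hxy).symm, hb, ha, ?_⟩
  intro y x y' x' h1 h2
  rcases hc x y x' y' h1 h2 with h | h
  · exact Or.inl h.symm
  · exact Or.inr h.symm

/-- All the mass at the top point `f` is sent to the top point `g`. The pair `(f, g)` dominates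
every other pair, so adding it to the support keeps a chain. -/
lemma HasMonotoneCoupling.of_erase {f : X} {g : Y} (hf : f ∈ F) (hg : g ∈ G)
    (hfmax : ∀ x ∈ F, α x ≤ α f) (hgmax : ∀ y ∈ G, β y ≤ β g) (haf : 0 ≤ a f)
    (h : HasMonotoneCoupling α β (F.erase f) G (Function.update a f 0)
      (Function.update b g (b g - a f))) :
    HasMonotoneCoupling α β F G a b := by
  obtain ⟨w, h0, hs, ha, hb, hc⟩ := h
  have hwf : ∀ y, w f y = 0 := by
    intro y
    by_contra hne
    exact Finset.notMem_erase f F (hs f y hne).1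
  have hcases : ∀ x y, w x y + (if x = f ∧ y = g then a f else 0) ≠ 0 →
      w x y ≠ 0 ∨ (x = f ∧ y = g) := by
    intro x y hxy
    by_contra! hcon
    exact hxy (by rw [hcon.1, if_neg fun h => hcon.2 h.1 h.2, add_zero])
  have hmem : ∀ x y, w x y + (if x = f ∧ y = g then a f else 0) ≠ 0 → x ∈ F ∧ y ∈ G := by
    intro x y hxy
    rcases hcases x y hxy with h | ⟨rfl, rfl⟩
    · exact ⟨Finset.mem_of_mem_erase (hs x y h).1, (hs x y h).2⟩
    · exact ⟨hf, hg⟩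
  refine ⟨fun x y => w x y + if x = f ∧ y = g then a f else 0, ?_, hmem, ?_, ?_, ?_⟩
  · intro x y
    refine add_nonneg (h0 x y) ?_
    split_ifs
    exacts [haf, le_rfl]
  · intro x
    rw [Finset.sum_add_distrib, ha]
    by_cases hx : x = f
    · subst hx
      simp [hg]
    · simp [hx]
  · intro y
    rw [Finset.sum_add_distrib, ← Finset.add_sum_erase _ _ hf, hwf, hb, zero_add]
    by_cases hy : y = g
    · subst hy
      simp [hf]
    · simp [hy]
  · intro x y x' y' h1 h2
    have hm1 := hmem x y h1
    have hm2 := hmem x' y' h2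
    rcases hcases x y h1 with h1 | ⟨rfl, rfl⟩
    · rcases hcases x' y' h2 with h2 | ⟨rfl, rfl⟩
      · exact hc x y x' y' h1 h2
      · exact Or.inl ⟨hfmax x hm1.1, hgmax y hm1.2⟩
    · exact Or.inr ⟨hfmax x' hm2.1, hgmax y' hm2.2⟩

lemma isWeight_update {s s' : Finset X} {w : X → ℝ} (hw : IsWeight s w) {f : X} {r : ℝ}
    (hr : 0 ≤ r) (hs : ∀ x ∈ s, x ≠ f → x ∈ s') (hf : f ∉ s' → r = 0) :
    IsWeight s' (Function.update w f r) where
  nonneg v := by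
    by_cases hv : v = f
    · subst hv
      rwa [Function.update_self]
    · rw [Function.update_of_ne hv]
      exact hw.nonneg v
  zero v hv' := by
    by_cases hv : v = f
    · subst hv
      rw [Function.update_self]
      exact hf hv'
    · rw [Function.update_of_ne hv]
      exact hw.zero v fun h => hv' (hs v h hv)

/-- The monotone coupling of two weights of the same mass. -/
lemma exists_monotone_coupling (α : X → ℕ) (β : Y → ℕ) (n : ℕ) : ∀ (F : Finset X)
    (G : Finset Y) (a : X → ℝ) (b : Y → ℝ), F.card + G.card = n → IsWeight F a → IsWeight G b →
    ∑ x ∈ F, a x = ∑ y ∈ G, b y → HasMonotoneCoupling α β F G a b := by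
  induction n with
  | zero =>
    intro F G a b hn ha hb _
    obtain ⟨hF, hG⟩ := Nat.add_eq_zero_iff.1 hn
    rw [Finset.card_eq_zero] at hF hG
    subst hF hG
    refine ⟨fun _ _ => 0, fun _ _ => le_rfl, fun _ _ h => absurd rfl h, fun x => ?_, fun y => ?_,
      fun _ _ _ _ h => absurd rfl h⟩
    · simp [ha.zero x]
    · simp [hb.zero y]
  | succ n ih =>
    intro F G a b hn ha hb hab
    by_cases h0 : ∑ x ∈ F, a x = 0
    · have ha0 := ha.eq_zero h0
      have hb0 := hb.eq_zero (hab ▸ h0)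
      subst ha0 hb0
      exact ⟨fun _ _ => 0, fun _ _ => le_rfl, fun _ _ h => absurd rfl h, fun x => by simp,
        fun y => by simp, fun _ _ _ _ h => absurd rfl h⟩
    have hFne : F.Nonempty := by
      rw [Finset.nonempty_iff_ne_empty]
      rintro rfl
      simp at h0
    have hGne : G.Nonempty := by
      rw [Finset.nonempty_iff_ne_empty]
      rintro rfl
      exact h0 (by rw [hab]; simp)
    obtain ⟨f, hf, hfmax⟩ := F.exists_max_image α hFne
    obtain ⟨g, hg, hgmax⟩ := G.exists_max_image β hGne
    have hcF := Finset.card_pos.2 hFne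
    have hcG := Finset.card_pos.2 hGne
    have hab' := hab
    rw [← Finset.add_sum_erase _ _ hf, ← Finset.add_sum_erase _ _ hg] at hab'
    -- Greedy step: the smaller of the two top masses is exhausted by matching it with the other
    -- one. Its point is erased, which lowers the total cardinality.
    rcases le_total (a f) (b g) with hle | hle
    · refine HasMonotoneCoupling.of_erase hf hg hfmax hgmax (ha.nonneg f) (ih _ _ _ _ ?_ ?_ ?_ ?_)
      · rw [Finset.card_erase_of_mem hf]
        omega
      · exact isWeight_update ha le_rfl (fun x hx hne => Finset.mem_erase.2 ⟨hne, hx⟩) fun _ => rfl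
      · exact isWeight_update hb (sub_nonneg.2 hle) (fun y hy _ => hy) fun h => absurd hg h
      · rw [Finset.sum_update_of_notMem (Finset.notMem_erase f F), Finset.sum_update_of_mem hg,
          ← Finset.erase_eq]
        linarith
    · refine (HasMonotoneCoupling.of_erase hg hf hgmax hfmax (hb.nonneg g)
        (ih _ _ _ _ ?_ ?_ ?_ ?_).swap).swap
      · rw [Finset.card_erase_of_mem hg]
        omega
      · exact isWeight_update ha (sub_nonneg.2 hle) (fun x hx _ => hx) fun h => absurd hf h
      · exact isWeight_update hb le_rfl (fun y hy hne => Finset.mem_erase.2 ⟨hne, hy⟩) fun _ => rfl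
      · rw [Finset.sum_update_of_notMem (Finset.notMem_erase g G), Finset.sum_update_of_mem hf,
          ← Finset.erase_eq]
        linarith

/-! ### Uniqueness of weights on chains with given marginals -/

variable {Z : Type*} {A B : Z → ℕ} {S S' : Finset Z} {w w' : Z → ℝ}

/-- The distribution function of a weight with totally ordered support. -/
lemma sum_filter_le_eq_min (hw : IsWeight S w)
    (hS : ∀ x ∈ S, ∀ y ∈ S, (A x ≤ A y ∧ B x ≤ B y) ∨ (A y ≤ A x ∧ B y ≤ B x)) (n k : ℕ) :
    ∑ z ∈ S with A z ≤ n ∧ B z ≤ k, w z =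
      min (∑ z ∈ S with A z ≤ n, w z) (∑ z ∈ S with B z ≤ k, w z) := by
  by_cases h : ∀ z ∈ S, A z ≤ n → B z ≤ k
  · have h1 : S.filter (fun z => A z ≤ n ∧ B z ≤ k) = S.filter (fun z => A z ≤ n) :=
      Finset.filter_congr fun z hz => ⟨fun h => h.1, fun h' => ⟨h', h z hz h'⟩⟩
    rw [h1, min_eq_left]
    refine Finset.sum_le_sum_of_subset_of_nonneg (fun z hz => ?_) fun z _ _ => hw.nonneg z
    rw [Finset.mem_filter] at hz ⊢
    exact ⟨hz.1, h z hz.1 hz.2⟩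
  · push Not at h
    obtain ⟨y, hy, hyn, hyk⟩ := h
    -- The witness `y` has `A y ≤ n` but `B y > k`; a point with `B z ≤ k` cannot lie above it in
    -- the chain, so it lies below and inherits the bound on `A`.
    have h' : ∀ z ∈ S, B z ≤ k → A z ≤ n := by
      intro z hz hzk
      rcases hS z hz y hy with h | h <;> omega
    have h1 : S.filter (fun z => A z ≤ n ∧ B z ≤ k) = S.filter (fun z => B z ≤ k) :=
      Finset.filter_congr fun z hz => ⟨fun h => h.2, fun h => ⟨h' z hz h, h⟩⟩
    rw [h1, min_eq_right]
    refine Finset.sum_le_sum_of_subset_of_nonneg (fun z hz => ?_) fun z _ _ => hw.nonneg z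
    rw [Finset.mem_filter] at hz ⊢
    exact ⟨hz.1, h' z hz.1 hz.2⟩

/-- Weights with totally ordered supports are determined by their marginals. -/
lemma weight_eq_of_marginals (hw : IsWeight S w) (hw' : IsWeight S' w')
    (hS : ∀ x ∈ S, ∀ y ∈ S, (A x ≤ A y ∧ B x ≤ B y) ∨ (A y ≤ A x ∧ B y ≤ B x))
    (hS' : ∀ x ∈ S', ∀ y ∈ S', (A x ≤ A y ∧ B x ≤ B y) ∨ (A y ≤ A x ∧ B y ≤ B x))
    (hinj : ∀ x ∈ S ∪ S', ∀ y ∈ S ∪ S', A x = A y → B x = B y → x = y)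
    (hA : ∀ n, ∑ z ∈ S with A z ≤ n, w z = ∑ z ∈ S' with A z ≤ n, w' z)
    (hB : ∀ n, ∑ z ∈ S with B z ≤ n, w z = ∑ z ∈ S' with B z ≤ n, w' z) : w = w' := by
  have hext : ∀ (R : Finset Z) (u : Z → ℝ) (p : Z → Prop) [DecidablePred p], R ⊆ S ∪ S' → IsWeight R u →
      ∑ z ∈ S ∪ S' with p z, u z = ∑ z ∈ R with p z, u z := by
    intro R u p _ hR hu
    rw [Finset.sum_filter, Finset.sum_filter]
    refine (Finset.sum_subset hR fun z _ hz => ?_).symm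
    rw [hu.zero z hz, ite_self]
  -- The joint distribution function is the minimum of the marginal ones, so the two agree; the
  -- weights themselves are then recovered by induction from the lower left corner.
  have hzero : ∀ n k, ∑ z ∈ S ∪ S' with A z ≤ n ∧ B z ≤ k, (w z - w' z) = 0 := by
    intro n k
    rw [Finset.sum_sub_distrib, hext S w _ Finset.subset_union_left hw,
      hext S' w' _ Finset.subset_union_right hw', sum_filter_le_eq_min hw hS,
      sum_filter_le_eq_min hw' hS', hA, hB, sub_self]
  have hind : ∀ N, ∀ z ∈ S ∪ S', A z + B z = N → w z - w' z = 0 := by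
    intro N
    induction N using Nat.strong_induction_on with
    | _ N ih =>
      intro z hz hN
      rw [← hzero (A z) (B z)]
      symm
      refine Finset.sum_eq_single_of_mem z (Finset.mem_filter.2 ⟨hz, le_rfl, le_rfl⟩) ?_
      intro y hy hyz
      obtain ⟨hy, h1, h2⟩ := Finset.mem_filter.1 hy
      -- A point dominated by `z` with the same rank sum has the same two ranks and equals `z` by
      -- injectivity.
      refine ih (A y + B y) ?_ y hy rfl
      by_contra! hcon
      exact hyz (hinj y hy z hz (by omega) (by omega))
  funext z
  by_cases hz : z ∈ S ∪ S'
  · exact sub_eq_zero.1 (hind _ z hz rfl)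
  · rw [Finset.mem_union, not_or] at hz
    rw [hw.zero z hz.1, hw'.zero z hz.2]

/-- The image of a weight under a map. -/
def pushWeight (S : Finset Z) (w : Z → ℝ) (f : Z → X) : X → ℝ := fun v => ∑ z ∈ S with f z = v, w z

lemma sum_pushWeight_smul {M : Type*} [AddCommGroup M] [Module ℝ M] {V : Finset X} {f : Z → X}
    (hV : ∀ z ∈ S, f z ∈ V) (g : X → M) :
    ∑ v ∈ V, pushWeight S w f v • g v = ∑ z ∈ S, w z • g (f z) := by
  rw [← Finset.sum_fiberwise_of_maps_to hV]
  refine Finset.sum_congr rfl fun v _ => ?_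
  rw [pushWeight, Finset.sum_smul]
  refine Finset.sum_congr rfl fun z hz => ?_
  rw [(Finset.mem_filter.1 hz).2]

lemma isWeight_pushWeight {V : Finset X} {f : Z → X} (hw : IsWeight S w)
    (hV : ∀ z ∈ S, f z ∈ V) : IsWeight V (pushWeight S w f) where
  nonneg v := Finset.sum_nonneg fun z _ => hw.nonneg z
  zero v hv := by
    rw [pushWeight, Finset.filter_false_of_mem, Finset.sum_empty]
    rintro z hz rfl
    exact hv (hV z hz)

lemma sum_pushWeight {V : Finset X} {f : Z → X} (hV : ∀ z ∈ S, f z ∈ V) :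
    ∑ v ∈ V, pushWeight S w f v = ∑ z ∈ S, w z := by
  simpa using sum_pushWeight_smul (w := w) hV fun _ => (1 : ℝ)

lemma sum_filter_pushWeight {V : Finset X} {f : Z → X} (hV : ∀ z ∈ S, f z ∈ V) (p : X → Prop)
    [DecidablePred p] :
    ∑ z ∈ S with p (f z), w z = ∑ v ∈ V with p v, pushWeight S w f v := by
  simpa [Finset.sum_filter] using
    (sum_pushWeight_smul (w := w) hV fun v => if p v then (1 : ℝ) else 0).symm

end Coupling

/-! ### The simplicial product as a triangulation -/

section Product

variable {ι κ : Type*}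

/-- The first component of a point of a product. -/
def fstPoint (z : ι ⊕ κ → ℝ) : ι → ℝ := fun i => z (Sum.inl i)

/-- The second component of a point of a product. -/
def sndPoint (z : ι ⊕ κ → ℝ) : κ → ℝ := fun j => z (Sum.inr j)

lemma point_ext {z z' : ι ⊕ κ → ℝ} (h1 : fstPoint z = fstPoint z')
    (h2 : sndPoint z = sndPoint z') : z = z' := by
  funext i
  rcases i with i | j
  · exact congrFun h1 i
  · exact congrFun h2 j

lemma fstPoint_sum {Z : Type*} (s : Finset Z) (w : Z → ℝ) (f : Z → ι ⊕ κ → ℝ) :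
    fstPoint (∑ z ∈ s, w z • f z) = ∑ z ∈ s, w z • fstPoint (f z) := by
  funext i
  simp [fstPoint]

lemma sndPoint_sum {Z : Type*} (s : Finset Z) (w : Z → ℝ) (f : Z → ι ⊕ κ → ℝ) :
    sndPoint (∑ z ∈ s, w z • f z) = ∑ z ∈ s, w z • sndPoint (f z) := by
  funext i
  simp [sndPoint]

/-- The projection of a face to the first factor. -/
def fstFace (F : Finset (ι ⊕ κ → ℝ)) : Finset (ι → ℝ) := F.image fstPoint

/-- The projection of a face to the second factor. -/
def sndFace (F : Finset (ι ⊕ κ → ℝ)) : Finset (κ → ℝ) := F.image sndPoint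

lemma mem_fstFace {F : Finset (ι ⊕ κ → ℝ)} {v : ι → ℝ} :
    v ∈ fstFace F ↔ ∃ z ∈ F, fstPoint z = v := Finset.mem_image

lemma mem_sndFace {F : Finset (ι ⊕ κ → ℝ)} {v : κ → ℝ} :
    v ∈ sndFace F ↔ ∃ z ∈ F, sndPoint z = v := Finset.mem_image

lemma fstPoint_mem_fstFace {F : Finset (ι ⊕ κ → ℝ)} {z : ι ⊕ κ → ℝ} (hz : z ∈ F) :
    fstPoint z ∈ fstFace F := mem_fstFace.2 ⟨z, hz, rfl⟩

lemma sndPoint_mem_sndFace {F : Finset (ι ⊕ κ → ℝ)} {z : ι ⊕ κ → ℝ} (hz : z ∈ F) :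
    sndPoint z ∈ sndFace F := mem_sndFace.2 ⟨z, hz, rfl⟩

/-- The points of `F` are pairwise comparable with respect to the rankings. -/
def IsRankChain (α : (ι → ℝ) → ℕ) (β : (κ → ℝ) → ℕ) (F : Finset (ι ⊕ κ → ℝ)) : Prop :=
  ∀ x ∈ F, ∀ y ∈ F, (α (fstPoint x) ≤ α (fstPoint y) ∧ β (sndPoint x) ≤ β (sndPoint y)) ∨
    (α (fstPoint y) ≤ α (fstPoint x) ∧ β (sndPoint y) ≤ β (sndPoint x))

/-- The simplicial product with respect to rankings of the vertices. -/
def rankedProduct (K : Set (Finset (ι → ℝ))) (L : Set (Finset (κ → ℝ)))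
    (α : (ι → ℝ) → ℕ) (β : (κ → ℝ) → ℕ) : Set (Finset (ι ⊕ κ → ℝ)) :=
  {F | fstFace F ∈ K ∧ sndFace F ∈ L ∧ IsRankChain α β F}

variable {K : Set (Finset (ι → ℝ))} {L : Set (Finset (κ → ℝ))}
  {P : Set (ι → ℝ)} {Q : Set (κ → ℝ)} {α : (ι → ℝ) → ℕ} {β : (κ → ℝ) → ℕ}

lemma simplicialProduct_eq_rankedProduct (hK : IsComplex K) (hL : IsComplex L)
    {r : (ι → ℝ) → (ι → ℝ) → Prop} {r' : (κ → ℝ) → (κ → ℝ) → Prop}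
    (hr : ∀ v ∈ vertices K, ∀ w ∈ vertices K, r v w ↔ α v ≤ α w)
    (hr' : ∀ v ∈ vertices L, ∀ w ∈ vertices L, r' v w ↔ β v ≤ β w) :
    simplicialProduct K L r r' = rankedProduct K L α β := by
  ext F
  refine and_congr_right fun h1 => and_congr_right fun h2 => ?_
  refine forall₂_congr fun x hx => forall₂_congr fun y hy => ?_
  have h1x := hK.mem_vertices h1 (fstPoint_mem_fstFace hx)
  have h1y := hK.mem_vertices h1 (fstPoint_mem_fstFace hy)
  have h2x := hL.mem_vertices h2 (sndPoint_mem_sndFace hx)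
  have h2y := hL.mem_vertices h2 (sndPoint_mem_sndFace hy)
  exact or_congr (and_congr (hr _ h1x _ h1y) (hr' _ h2x _ h2y))
    (and_congr (hr _ h1y _ h1x) (hr' _ h2y _ h2x))

lemma fstPoint_mem_vertices (hK : IsComplex K) {F : Finset (ι ⊕ κ → ℝ)}
    (hF : F ∈ rankedProduct K L α β) {z : ι ⊕ κ → ℝ} (hz : z ∈ F) : fstPoint z ∈ vertices K :=
  hK.mem_vertices hF.1 (fstPoint_mem_fstFace hz)

lemma sndPoint_mem_vertices (hL : IsComplex L) {F : Finset (ι ⊕ κ → ℝ)}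
    (hF : F ∈ rankedProduct K L α β) {z : ι ⊕ κ → ℝ} (hz : z ∈ F) : sndPoint z ∈ vertices L :=
  hL.mem_vertices hF.2.1 (sndPoint_mem_sndFace hz)

lemma rankedProduct_down (hK : IsComplex K) (hL : IsComplex L) {F G : Finset (ι ⊕ κ → ℝ)}
    (hF : F ∈ rankedProduct K L α β) (hG : G ⊆ F) (hne : G.Nonempty) :
    G ∈ rankedProduct K L α β :=
  ⟨hK.down _ hF.1 _ (Finset.image_subset_image hG) (hne.image _),
    hL.down _ hF.2.1 _ (Finset.image_subset_image hG) (hne.image _),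
    fun x hx y hy => hF.2.2 x (hG hx) y (hG hy)⟩

lemma vertices_rankedProduct :
    vertices (rankedProduct K L α β) =
      {z | fstPoint z ∈ vertices K ∧ sndPoint z ∈ vertices L} := by
  ext z
  have h1 : fstFace {z} = {fstPoint z} := Finset.image_singleton _ _
  have h2 : sndFace {z} = {sndPoint z} := Finset.image_singleton _ _
  simp only [vertices, rankedProduct, Set.mem_ofPred_eq, h1, h2]
  refine ⟨fun h => ⟨h.1, h.2.1⟩, fun h => ⟨h.1, h.2, fun x hx y hy => ?_⟩⟩
  rw [Finset.mem_singleton.1 hx, Finset.mem_singleton.1 hy]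
  exact Or.inl ⟨le_rfl, le_rfl⟩

/-- Projecting a weight gives weights on faces of `K` and `L`, and these are determined by the
projected moments. A weight supported on a chain is in turn determined by its two marginals. -/
lemma isComplex_rankedProduct (hK : IsComplex K) (hL : IsComplex L)
    (hα : Set.InjOn α (vertices K)) (hβ : Set.InjOn β (vertices L)) :
    IsComplex (rankedProduct K L α β) where
  nonempty F hF := Finset.image_nonempty.1 (hK.nonempty _ hF.1)
  down F hF G hG hne := rankedProduct_down hK hL hF hG hne
  unique := by
    intro S hS T hT w w' hw hw' h0 h1
    have e1 : pushWeight S w fstPoint = pushWeight T w' fstPoint := by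
      refine hK.unique _ hS.1 _ hT.1 _ _
        (isWeight_pushWeight hw fun z hz => fstPoint_mem_fstFace hz)
        (isWeight_pushWeight hw' fun z hz => fstPoint_mem_fstFace hz) ?_ ?_
      · rw [sum_pushWeight fun z hz => fstPoint_mem_fstFace hz,
          sum_pushWeight fun z hz => fstPoint_mem_fstFace hz, h0]
      · rw [sum_pushWeight_smul fun z hz => fstPoint_mem_fstFace hz,
          sum_pushWeight_smul fun z hz => fstPoint_mem_fstFace hz]
        have := congrArg fstPoint h1
        rwa [fstPoint_sum, fstPoint_sum] at this
    have e2 : pushWeight S w sndPoint = pushWeight T w' sndPoint := by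
      refine hL.unique _ hS.2.1 _ hT.2.1 _ _
        (isWeight_pushWeight hw fun z hz => sndPoint_mem_sndFace hz)
        (isWeight_pushWeight hw' fun z hz => sndPoint_mem_sndFace hz) ?_ ?_
      · rw [sum_pushWeight fun z hz => sndPoint_mem_sndFace hz,
          sum_pushWeight fun z hz => sndPoint_mem_sndFace hz, h0]
      · rw [sum_pushWeight_smul fun z hz => sndPoint_mem_sndFace hz,
          sum_pushWeight_smul fun z hz => sndPoint_mem_sndFace hz]
        have := congrArg sndPoint h1
        rwa [sndPoint_sum, sndPoint_sum] at this
    have hv1 : ∀ z ∈ S ∪ T, fstPoint z ∈ vertices K := fun z hz =>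
      (Finset.mem_union.1 hz).elim (fstPoint_mem_vertices hK hS) (fstPoint_mem_vertices hK hT)
    have hv2 : ∀ z ∈ S ∪ T, sndPoint z ∈ vertices L := fun z hz =>
      (Finset.mem_union.1 hz).elim (sndPoint_mem_vertices hL hS) (sndPoint_mem_vertices hL hT)
    refine weight_eq_of_marginals (A := fun z => α (fstPoint z)) (B := fun z => β (sndPoint z))
      hw hw' hS.2.2 hT.2.2 ?_ ?_ ?_
    · intro x hx y hy h1 h2
      exact point_ext (hα (hv1 x hx) (hv1 y hy) h1) (hβ (hv2 x hx) (hv2 y hy) h2)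
    · intro n
      rw [sum_filter_pushWeight (V := fstFace (S ∪ T))
          (fun z hz => fstPoint_mem_fstFace (Finset.mem_union_left _ hz)) fun v => α v ≤ n,
        sum_filter_pushWeight (V := fstFace (S ∪ T))
          (fun z hz => fstPoint_mem_fstFace (Finset.mem_union_right _ hz)) fun v => α v ≤ n, e1]
    · intro n
      rw [sum_filter_pushWeight (V := sndFace (S ∪ T))
          (fun z hz => sndPoint_mem_sndFace (Finset.mem_union_left _ hz)) fun v => β v ≤ n,
        sum_filter_pushWeight (V := sndFace (S ∪ T))
          (fun z hz => sndPoint_mem_sndFace (Finset.mem_union_right _ hz)) fun v => β v ≤ n, e2]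

lemma mem_productSet {z : ι ⊕ κ → ℝ} :
    z ∈ productSet P Q ↔ fstPoint z ∈ P ∧ sndPoint z ∈ Q := Iff.rfl

lemma sum_filter_ne_zero_smul {X Y M : Type*} [AddCommGroup M] [Module ℝ M] (F : Finset X)
    (G : Finset Y) (w : X → Y → ℝ) (f : X × Y → M) :
    ∑ y ∈ (F ×ˢ G).filter (fun y => w y.1 y.2 ≠ 0), w y.1 y.2 • f y =
      ∑ u ∈ F, ∑ v ∈ G, w u v • f (u, v) := by
  rw [← Finset.sum_product' F G fun u v => w u v • f (u, v)]
  refine Finset.sum_subset (Finset.filter_subset _ _) fun y hy hyT => ?_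
  have : w y.1 y.2 = 0 := by
    by_contra hne
    exact hyT (Finset.mem_filter.2 ⟨hy, hne⟩)
  rw [this, zero_smul]

/-- For the covering, the weights of the two components of a point are coupled monotonically; the
support of the coupling is the required face. -/
lemma isTriangulation_rankedProduct (hK : IsTriangulation K P) (hL : IsTriangulation L Q)
    (hα : Set.InjOn α (vertices K)) (hβ : Set.InjOn β (vertices L)) :
    IsTriangulation (rankedProduct K L α β) (productSet P Q) := by
  obtain ⟨hKf, hKC, hKcov⟩ := isTriangulation_iff.1 hK
  obtain ⟨hLf, hLC, hLcov⟩ := isTriangulation_iff.1 hL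
  refine isTriangulation_iff.2 ⟨?_, isComplex_rankedProduct hKC hLC hα hβ, fun x => ?_⟩
  · have hV : (vertices (rankedProduct K L α β)).Finite := by
      rw [vertices_rankedProduct]
      refine Set.Finite.of_finite_image (f := fun z => (fstPoint z, sndPoint z))
        (((finite_vertices hKf).prod (finite_vertices hLf)).subset ?_) ?_
      · rintro _ ⟨z, hz, rfl⟩
        exact hz
      · intro z _ z' _ h
        exact point_ext (Prod.ext_iff.1 h).1 (Prod.ext_iff.1 h).2
    refine hV.toFinset.powerset.finite_toSet.subset fun F hF => ?_
    refine Finset.mem_coe.2 (Finset.mem_powerset.2 fun v hv => hV.mem_toFinset.2 ?_)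
    exact (isComplex_rankedProduct hKC hLC hα hβ).mem_vertices hF hv
  · rw [mem_productSet, hKcov, hLcov]
    constructor
    · rintro ⟨⟨F, hF, hxF⟩, G, hG, hxG⟩
      obtain ⟨a, ha, ha1, hax⟩ := mem_convexHull_iff_weight.1 hxF
      obtain ⟨b, hb, hb1, hbx⟩ := mem_convexHull_iff_weight.1 hxG
      obtain ⟨w, hw0, hws, hwa, hwb, hwc⟩ := exists_monotone_coupling α β _ F G a b rfl ha hb
        (ha1.trans hb1.symm)
      -- Only pairs of nonzero weight are kept: the full product of the faces is not a chain in
      -- general.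
      let T : Finset ((ι → ℝ) × (κ → ℝ)) := (F ×ˢ G).filter fun y => w y.1 y.2 ≠ 0
      have hT1 : ∑ y ∈ T, w y.1 y.2 = 1 := by
        have := sum_filter_ne_zero_smul F G w fun _ => (1 : ℝ)
        simp only [smul_eq_mul, mul_one] at this
        rw [this]
        simp_rw [hwa]
        exact ha1
      have hTfst : ∑ y ∈ T, w y.1 y.2 • y.1 = fstPoint x := by
        rw [sum_filter_ne_zero_smul F G w fun y => y.1]
        simp_rw [← Finset.sum_smul, hwa]
        exact hax
      have hTsnd : ∑ y ∈ T, w y.1 y.2 • y.2 = sndPoint x := by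
        rw [sum_filter_ne_zero_smul F G w fun y => y.2, Finset.sum_comm]
        simp_rw [← Finset.sum_smul, hwb]
        exact hbx
      have hTne : T.Nonempty := by
        rw [Finset.nonempty_iff_ne_empty]
        intro h
        rw [h] at hT1
        simp at hT1
      have hTmem : ∀ y ∈ T, y.1 ∈ F ∧ y.2 ∈ G ∧ w y.1 y.2 ≠ 0 := fun y hy => by
        have := Finset.mem_filter.1 hy
        exact ⟨(Finset.mem_product.1 this.1).1, (Finset.mem_product.1 this.1).2, this.2⟩
      refine ⟨T.image fun y => Sum.elim y.1 y.2, ⟨?_, ?_, ?_⟩, ?_⟩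
      · refine hKC.down F hF _ ?_ ((hTne.image _).image _)
        intro v hv
        obtain ⟨z, hz, rfl⟩ := mem_fstFace.1 hv
        obtain ⟨y, hy, rfl⟩ := Finset.mem_image.1 hz
        exact (hTmem y hy).1
      · refine hLC.down G hG _ ?_ ((hTne.image _).image _)
        intro v hv
        obtain ⟨z, hz, rfl⟩ := mem_sndFace.1 hv
        obtain ⟨y, hy, rfl⟩ := Finset.mem_image.1 hz
        exact (hTmem y hy).2.1
      · intro z hz z' hz'
        obtain ⟨y, hy, rfl⟩ := Finset.mem_image.1 hz
        obtain ⟨y', hy', rfl⟩ := Finset.mem_image.1 hz'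
        exact hwc _ _ _ _ (hTmem y hy).2.2 (hTmem y' hy').2.2
      · have hxT : x = ∑ y ∈ T, w y.1 y.2 • (Sum.elim y.1 y.2 : ι ⊕ κ → ℝ) := by
          refine point_ext ?_ ?_
          · rw [fstPoint_sum, ← hTfst]
            rfl
          · rw [sndPoint_sum, ← hTsnd]
            rfl
        rw [hxT]
        refine (convex_convexHull ℝ _).sum_mem (fun y _ => hw0 _ _) hT1 fun y hy => ?_
        exact subset_convexHull ℝ _ (Finset.mem_coe.2 (Finset.mem_image_of_mem _ hy))
    · rintro ⟨S, hS, hx⟩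
      obtain ⟨w, hw, hw1, hwx⟩ := mem_convexHull_iff_weight.1 hx
      refine ⟨⟨_, hS.1, ?_⟩, _, hS.2.1, ?_⟩
      · rw [← hwx, fstPoint_sum]
        exact (convex_convexHull ℝ _).sum_mem (fun y _ => hw.nonneg y) hw1 fun y hy =>
          subset_convexHull ℝ _ (Finset.mem_coe.2 (fstPoint_mem_fstFace hy))
      · rw [← hwx, sndPoint_sum]
        exact (convex_convexHull ℝ _).sum_mem (fun y _ => hw.nonneg y) hw1 fun y hy =>
          subset_convexHull ℝ _ (Finset.mem_coe.2 (sndPoint_mem_sndFace hy))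

lemma convex_productSet (hP : Convex ℝ P) (hQ : Convex ℝ Q) : Convex ℝ (productSet P Q) := by
  intro x hx y hy a b ha hb hab
  exact ⟨hP hx.1 hy.1 ha hb hab, hQ hx.2 hy.2 ha hb hab⟩

lemma interior_productSet_nonempty (hP : (interior P).Nonempty) (hQ : (interior Q).Nonempty) :
    (interior (productSet P Q)).Nonempty := by
  obtain ⟨x, hx⟩ := hP
  obtain ⟨y, hy⟩ := hQ
  have h1 : Continuous (fstPoint : (ι ⊕ κ → ℝ) → ι → ℝ) := by
    unfold fstPoint
    fun_prop
  have h2 : Continuous (sndPoint : (ι ⊕ κ → ℝ) → κ → ℝ) := by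
    unfold sndPoint
    fun_prop
  refine ⟨Sum.elim x y, mem_interior.2 ⟨fstPoint ⁻¹' interior P ∩ sndPoint ⁻¹' interior Q, ?_,
    (isOpen_interior.preimage h1).inter (isOpen_interior.preimage h2), hx, hy⟩⟩
  rintro z ⟨hz1, hz2⟩
  exact ⟨interior_subset hz1, interior_subset hz2⟩

variable {m n : ℕ} {c₁ : (ι → ℝ) → Fin (m + 1)} {c₂ : (κ → ℝ) → Fin (n + 1)}

/-- The sum of the colors of the components. -/
def sumColoring (c₁ : (ι → ℝ) → Fin (m + 1)) (c₂ : (κ → ℝ) → Fin (n + 1)) (z : ι ⊕ κ → ℝ) :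
    Fin (m + n + 1) :=
  ⟨c₁ (fstPoint z) + c₂ (sndPoint z), by omega⟩

/-- An injective ranking of the vertices such that the coloring is monotone. -/
structure IsColorRanking {E : Type*} {d : ℕ} (K : Set (Finset E)) (c : E → Fin (d + 1))
    (α : E → ℕ) : Prop where
  injOn : Set.InjOn α (vertices K)
  monotone : ∀ v ∈ vertices K, ∀ w ∈ vertices K, α v ≤ α w → c v ≤ c w

/-- Along a chain both colors are weakly monotone, so equal sums force equal colors in each
component; the colorings of the factors then identify both components. -/
lemma sumColoring_isColoring (hK : IsComplex K) (hL : IsComplex L)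
    (hc₁ : IsColoring m K c₁) (hc₂ : IsColoring n L c₂)
    (hα : IsColorRanking K c₁ α) (hβ : IsColorRanking L c₂ β) :
    IsColoring (m + n) (rankedProduct K L α β) (sumColoring c₁ c₂) := by
  intro F hF x hx y hy hxy
  have hx1 := fstPoint_mem_vertices hK hF hx
  have hy1 := fstPoint_mem_vertices hK hF hy
  have hx2 := sndPoint_mem_vertices hL hF hx
  have hy2 := sndPoint_mem_vertices hL hF hy
  have hsum : (c₁ (fstPoint x) : ℕ) + c₂ (sndPoint x) = c₁ (fstPoint y) + c₂ (sndPoint y) :=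
    congrArg Fin.val hxy
  have heq : c₁ (fstPoint x) = c₁ (fstPoint y) ∧ c₂ (sndPoint x) = c₂ (sndPoint y) := by
    rcases hF.2.2 x hx y hy with ⟨h1, h2⟩ | ⟨h1, h2⟩
    · have h3 := Fin.le_def.1 (hα.monotone _ hx1 _ hy1 h1)
      have h4 := Fin.le_def.1 (hβ.monotone _ hx2 _ hy2 h2)
      constructor <;> apply Fin.ext <;> omega
    · have h3 := Fin.le_def.1 (hα.monotone _ hy1 _ hx1 h1)
      have h4 := Fin.le_def.1 (hβ.monotone _ hy2 _ hx2 h2)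
      constructor <;> apply Fin.ext <;> omega
  exact point_ext (hc₁ _ hF.1 (fstPoint_mem_fstFace hx) (fstPoint_mem_fstFace hy) heq.1)
    (hc₂ _ hF.2.1 (sndPoint_mem_sndFace hx) (sndPoint_mem_sndFace hy) heq.2)

lemma mem_latticePoints_iff {z : ι ⊕ κ → ℝ} :
    z ∈ latticePoints (ι ⊕ κ) ↔
      fstPoint z ∈ latticePoints ι ∧ sndPoint z ∈ latticePoints κ := by
  constructor
  · rintro ⟨y, rfl⟩
    exact ⟨⟨fun i => y (Sum.inl i), rfl⟩, ⟨fun i => y (Sum.inr i), rfl⟩⟩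
  · rintro ⟨⟨y1, h1⟩, y2, h2⟩
    refine ⟨Sum.elim y1 y2, point_ext ?_ ?_⟩
    · rw [← h1]
      rfl
    · rw [← h2]
      rfl

theorem IsColoredTriangulation.rankedProduct [Fintype ι] [Fintype κ]
    (hK : IsColoredTriangulation m K P c₁) (hL : IsColoredTriangulation n L Q c₂)
    (hα : IsColorRanking K c₁ α) (hβ : IsColorRanking L c₂ β) :
    IsColoredTriangulation (m + n) (rankedProduct K L α β) (productSet P Q)
      (sumColoring c₁ c₂) where
  triangulation := isTriangulation_rankedProduct hK.triangulation hL.triangulation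
    hα.injOn hβ.injOn
  convex := convex_productSet hK.convex hL.convex
  interior_nonempty := interior_productSet_nonempty hK.interior_nonempty hL.interior_nonempty
  lattice := by
    rw [vertices_rankedProduct]
    exact fun z hz => mem_latticePoints_iff.2 ⟨hK.lattice hz.1, hL.lattice hz.2⟩
  coloring := sumColoring_isColoring hK.isComplex hL.isComplex hK.coloring hL.coloring hα hβ

end Product

/-! ### Staircases and the facets of the simplicial product -/

section Staircase

variable {m n : ℕ} {π : Fin (m + n + 1) → Fin (m + 1) × Fin (n + 1)}

lemma IsStaircase.sum_eq (h : IsStaircase m n π) (t : Fin (m + n + 1)) :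
    ((π t).1 : ℕ) + (π t).2 = t := by
  induction t using Fin.induction with
  | zero => simp [h.1]
  | succ i ih =>
    rw [Fin.val_castSucc] at ih
    rw [Fin.val_succ]
    rcases h.2.2 i with ⟨h1, h2⟩ | ⟨h1, h2⟩
    · rw [h1, h2]
      omega
    · rw [h1, h2]
      omega

lemma IsStaircase.monotone (h : IsStaircase m n π) : Monotone π := by
  rw [Fin.monotone_iff_le_succ]
  intro i
  rcases h.2.2 i with ⟨h1, h2⟩ | ⟨h1, h2⟩
  · exact Prod.mk_le_mk.2 ⟨Fin.le_def.2 (by omega), h2.ge⟩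
  · exact Prod.mk_le_mk.2 ⟨h1.ge, Fin.le_def.2 (by omega)⟩

/-- A discrete intermediate value argument: the coordinate rises from 0 to its maximum by at most
one per step. -/
lemma IsStaircase.surjective_fst (h : IsStaircase m n π) (a : Fin (m + 1)) :
    ∃ t, (π t).1 = a := by
  have key : ∀ t : Fin (m + n + 1), a ≤ (π t).1 → ∃ s, (π s).1 = a := by
    intro t
    induction t using Fin.induction with
    | zero =>
      intro ha
      rw [h.1] at ha
      exact ⟨0, by rw [h.1]; exact (Fin.le_zero_iff.1 ha).symm⟩
    | succ i ih =>
      intro ha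
      by_cases heq : (π i.succ).1 = a
      · exact ⟨_, heq⟩
      · refine ih (Fin.le_def.2 ?_)
        have h1 := Fin.le_def.1 ha
        have h2 : ((π i.succ).1 : ℕ) ≠ a := fun h => heq (Fin.ext h)
        rcases h.2.2 i with ⟨h3, -⟩ | ⟨h3, -⟩
        · omega
        · rw [h3] at h1 h2
          omega
  exact key (Fin.last _) (by rw [h.2.1]; exact Fin.le_last a)

lemma IsStaircase.surjective_snd (h : IsStaircase m n π) (b : Fin (n + 1)) :
    ∃ t, (π t).2 = b := by
  have key : ∀ t : Fin (m + n + 1), b ≤ (π t).2 → ∃ s, (π s).2 = b := by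
    intro t
    induction t using Fin.induction with
    | zero =>
      intro ha
      rw [h.1] at ha
      exact ⟨0, by rw [h.1]; exact (Fin.le_zero_iff.1 ha).symm⟩
    | succ i ih =>
      intro ha
      by_cases heq : (π i.succ).2 = b
      · exact ⟨_, heq⟩
      · refine ih (Fin.le_def.2 ?_)
        have h1 := Fin.le_def.1 ha
        have h2 : ((π i.succ).2 : ℕ) ≠ b := fun h => heq (Fin.ext h)
        rcases h.2.2 i with ⟨-, h3⟩ | ⟨-, h3⟩
        · rw [h3] at h1 h2
          omega
        · omega
  exact key (Fin.last _) (by rw [h.2.1]; exact Fin.le_last b)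

/-- The points of a product of two simplices along a path in the grid. -/
def pathFacet {ι κ : Type*} (p : Fin (m + 1) → ι → ℝ) (q : Fin (n + 1) → κ → ℝ)
    (π : Fin (m + n + 1) → Fin (m + 1) × Fin (n + 1)) : Fin (m + n + 1) → ι ⊕ κ → ℝ :=
  fun t => Sum.elim (p (π t).1) (q (π t).2)

/-! ### Facets of the simplicial product as staircases over pairs of facets -/

section ColoredFacets

variable {ι κ : Type*} {K : Set (Finset (ι → ℝ))} {L : Set (Finset (κ → ℝ))}
  {α : (ι → ℝ) → ℕ} {β : (κ → ℝ) → ℕ}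
  {c₁ : (ι → ℝ) → Fin (m + 1)} {c₂ : (κ → ℝ) → Fin (n + 1)}
  {p : Fin (m + 1) → ι → ℝ} {q : Fin (n + 1) → κ → ℝ}

lemma IsColorRanking.le_of_le {E : Type*} {d : ℕ} {K : Set (Finset E)} {c : E → Fin (d + 1)}
    {α : E → ℕ} (h : IsColorRanking K c α) {p : Fin (d + 1) → E} (hp : ∀ i, p i ∈ vertices K)
    (hc : ∀ i, c (p i) = i) {i j : Fin (d + 1)} (hij : i ≤ j) : α (p i) ≤ α (p j) := by
  rcases hij.eq_or_lt with rfl | hlt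
  · exact le_rfl
  · by_contra! hcon
    have := h.monotone _ (hp j) _ (hp i) hcon.le
    rw [hc, hc] at this
    exact hlt.not_ge this

lemma pathFacet_mem (hK : IsComplex K) (hL : IsComplex L)
    (hα : IsColorRanking K c₁ α) (hβ : IsColorRanking L c₂ β)
    (hp : p ∈ coloredFacets K c₁) (hq : q ∈ coloredFacets L c₂) (hπ : IsStaircase m n π) :
    pathFacet p q π ∈ coloredFacets (rankedProduct K L α β) (sumColoring c₁ c₂) := by
  have hfst : fstFace (valueFinset (pathFacet p q π)) = valueFinset p := by
    ext v
    rw [mem_fstFace, mem_valueFinset]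
    constructor
    · rintro ⟨z, hz, rfl⟩
      obtain ⟨t, rfl⟩ := mem_valueFinset.1 hz
      exact ⟨_, rfl⟩
    · rintro ⟨a, rfl⟩
      obtain ⟨t, rfl⟩ := hπ.surjective_fst a
      exact ⟨_, apply_mem_valueFinset _ t, rfl⟩
  have hsnd : sndFace (valueFinset (pathFacet p q π)) = valueFinset q := by
    ext v
    rw [mem_sndFace, mem_valueFinset]
    constructor
    · rintro ⟨z, hz, rfl⟩
      obtain ⟨t, rfl⟩ := mem_valueFinset.1 hz
      exact ⟨_, rfl⟩
    · rintro ⟨a, rfl⟩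
      obtain ⟨t, rfl⟩ := hπ.surjective_snd a
      exact ⟨_, apply_mem_valueFinset _ t, rfl⟩
  have hpv : ∀ i, p i ∈ vertices K := fun i => hK.mem_vertices hp.1 (apply_mem_valueFinset p i)
  have hqv : ∀ i, q i ∈ vertices L := fun i => hL.mem_vertices hq.1 (apply_mem_valueFinset q i)
  refine ⟨⟨hfst ▸ hp.1, hsnd ▸ hq.1, ?_⟩, fun t => Fin.ext ?_⟩
  · intro x hx y hy
    obtain ⟨s, rfl⟩ := mem_valueFinset.1 hx
    obtain ⟨t, rfl⟩ := mem_valueFinset.1 hy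
    rcases le_total s t with hst | hst
    · exact Or.inl ⟨hα.le_of_le hpv hp.2 (hπ.monotone hst).1, hβ.le_of_le hqv hq.2 (hπ.monotone hst).2⟩
    · exact Or.inr ⟨hα.le_of_le hpv hp.2 (hπ.monotone hst).1, hβ.le_of_le hqv hq.2 (hπ.monotone hst).2⟩
  · change (c₁ (p (π t).1) : ℕ) + c₂ (q (π t).2) = t
    rw [hp.2, hq.2, hπ.sum_eq]

/-- The path is read off from the pairs of colors. The color sum increases by one from each vertex
to the next, while comparability moves both colors in the same weak direction, so exactly one of
them increases, by one. Within a projected face the color determines the vertex, which makes `p` and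
`q` well defined. -/
lemma exists_pathFacet (hK : IsComplex K) (hL : IsComplex L)
    (hc₁ : IsColoring m K c₁) (hc₂ : IsColoring n L c₂)
    (hα : IsColorRanking K c₁ α) (hβ : IsColorRanking L c₂ β) {z : Fin (m + n + 1) → ι ⊕ κ → ℝ}
    (hz : z ∈ coloredFacets (rankedProduct K L α β) (sumColoring c₁ c₂)) :
    ∃ p ∈ coloredFacets K c₁, ∃ q ∈ coloredFacets L c₂, ∃ π, IsStaircase m n π ∧
      pathFacet p q π = z := by
  let π : Fin (m + n + 1) → Fin (m + 1) × Fin (n + 1) :=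
    fun t => (c₁ (fstPoint (z t)), c₂ (sndPoint (z t)))
  have hsum : ∀ t, ((π t).1 : ℕ) + (π t).2 = t := fun t => congrArg Fin.val (hz.2 t)
  have hzm := fun t => apply_mem_valueFinset z t
  have hv1 := fun t => fstPoint_mem_vertices hK hz.1 (hzm t)
  have hv2 := fun t => sndPoint_mem_vertices hL hz.1 (hzm t)
  have hπ : IsStaircase m n π := by
    refine ⟨?_, ?_, fun i => ?_⟩
    · have := hsum 0
      rw [Fin.val_zero] at this
      refine Prod.ext (Fin.ext ?_) (Fin.ext ?_)
      · simp only [Fin.val_zero]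
        omega
      · simp only [Fin.val_zero]
        omega
    · have := hsum (Fin.last _)
      rw [Fin.val_last] at this
      have h1 := (π (Fin.last _)).1.is_lt
      have h2 := (π (Fin.last _)).2.is_lt
      refine Prod.ext (Fin.ext ?_) (Fin.ext ?_)
      · simp only [Fin.val_last]
        omega
      · simp only [Fin.val_last]
        omega
    · have h1 := hsum i.succ
      have h2 := hsum i.castSucc
      rw [Fin.val_succ] at h1
      rw [Fin.val_castSucc] at h2
      rcases hz.1.2.2 _ (hzm i.castSucc) _ (hzm i.succ) with ⟨h3, h4⟩ | ⟨h3, h4⟩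
      · have h5 : ((π i.castSucc).1 : ℕ) ≤ (π i.succ).1 :=
          Fin.le_def.1 (hα.monotone _ (hv1 _) _ (hv1 _) h3)
        have h6 : ((π i.castSucc).2 : ℕ) ≤ (π i.succ).2 :=
          Fin.le_def.1 (hβ.monotone _ (hv2 _) _ (hv2 _) h4)
        by_cases h7 : ((π i.castSucc).1 : ℕ) = (π i.succ).1
        · exact Or.inr ⟨Fin.ext h7.symm, by omega⟩
        · exact Or.inl ⟨by omega, Fin.ext (by omega)⟩
      -- The reverse comparison would make the color sum weakly decrease, although it increases by
      -- one.
      · have h5 : ((π i.succ).1 : ℕ) ≤ (π i.castSucc).1 :=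
          Fin.le_def.1 (hα.monotone _ (hv1 _) _ (hv1 _) h3)
        have h6 : ((π i.succ).2 : ℕ) ≤ (π i.castSucc).2 :=
          Fin.le_def.1 (hβ.monotone _ (hv2 _) _ (hv2 _) h4)
        omega
  choose s hs using hπ.surjective_fst
  choose t ht using hπ.surjective_snd
  have hp : ∀ i, fstPoint (z (s (π i).1)) = fstPoint (z i) := fun i =>
    hc₁ _ hz.1.1 (fstPoint_mem_fstFace (hzm _)) (fstPoint_mem_fstFace (hzm _)) (hs (π i).1)
  have hq : ∀ i, sndPoint (z (t (π i).2)) = sndPoint (z i) := fun i =>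
    hc₂ _ hz.1.2.1 (sndPoint_mem_sndFace (hzm _)) (sndPoint_mem_sndFace (hzm _)) (ht (π i).2)
  refine ⟨fun a => fstPoint (z (s a)), ⟨?_, hs⟩, fun b => sndPoint (z (t b)), ⟨?_, ht⟩, π, hπ, ?_⟩
  · convert hz.1.1
    ext v
    rw [mem_fstFace, mem_valueFinset]
    constructor
    · rintro ⟨a, rfl⟩
      exact ⟨_, hzm _, rfl⟩
    · rintro ⟨y, hy, rfl⟩
      obtain ⟨i, rfl⟩ := mem_valueFinset.1 hy
      exact ⟨_, hp i⟩
  · convert hz.1.2.1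
    ext v
    rw [mem_sndFace, mem_valueFinset]
    constructor
    · rintro ⟨a, rfl⟩
      exact ⟨_, hzm _, rfl⟩
    · rintro ⟨y, hy, rfl⟩
      obtain ⟨i, rfl⟩ := mem_valueFinset.1 hy
      exact ⟨_, hq i⟩
  · funext i
    exact point_ext (hp i) (hq i)

/-- For injectivity, the colors of the components recover the path; since a staircase visits every
row and column, all vertices of `p` and `q` are recovered too. -/
lemma bijOn_pathFacet (hK : IsComplex K) (hL : IsComplex L)
    (hc₁ : IsColoring m K c₁) (hc₂ : IsColoring n L c₂)
    (hα : IsColorRanking K c₁ α) (hβ : IsColorRanking L c₂ β) :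
    Set.BijOn (fun y : (Fin (m + n + 1) → Fin (m + 1) × Fin (n + 1)) ×
        (Fin (m + 1) → ι → ℝ) × (Fin (n + 1) → κ → ℝ) => pathFacet y.2.1 y.2.2 y.1)
      ({π | IsStaircase m n π} ×ˢ coloredFacets K c₁ ×ˢ coloredFacets L c₂)
      (coloredFacets (rankedProduct K L α β) (sumColoring c₁ c₂)) := by
  refine ⟨?_, ?_, ?_⟩
  · rintro ⟨π, p, q⟩ ⟨hπ, hp, hq⟩
    exact pathFacet_mem hK hL hα hβ hp hq hπ
  · rintro ⟨π, p, q⟩ ⟨hπ, hp, hq⟩ ⟨π', p', q'⟩ ⟨hπ', hp', hq'⟩ heq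
    have h1 : ∀ t, p (π t).1 = p' (π' t).1 := fun t => congrArg fstPoint (congrFun heq t)
    have h2 : ∀ t, q (π t).2 = q' (π' t).2 := fun t => congrArg sndPoint (congrFun heq t)
    have hππ : π = π' := by
      funext t
      refine Prod.ext ?_ ?_
      · have := congrArg c₁ (h1 t)
        rwa [hp.2, hp'.2] at this
      · have := congrArg c₂ (h2 t)
        rwa [hq.2, hq'.2] at this
    subst hππ
    refine Prod.ext rfl (Prod.ext (funext fun a => ?_) (funext fun b => ?_))
    · obtain ⟨t, rfl⟩ := IsStaircase.surjective_fst hπ a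
      exact h1 t
    · obtain ⟨t, rfl⟩ := IsStaircase.surjective_snd hπ b
      exact h2 t
  · intro z hz
    obtain ⟨p, hp, q, hq, π, hπ, h⟩ := exists_pathFacet hK hL hc₁ hc₂ hα hβ hz
    exact ⟨(π, p, q), ⟨hπ, hp, hq⟩, h⟩

end ColoredFacets

/-! ### Multiplicativity of the signed count -/

/-- This is the affine interpolation of `f` on the standard simplex, relative to its value at the
origin vertex. -/
lemma sum_simplexVertex_mul (a : Fin (m + 1)) (f : Fin (m + 1) → ℝ) :
    ∑ k : Fin m, simplexVertex m a k * (f k.succ - f 0) = f a - f 0 := by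
  refine Fin.cases ?_ (fun i => ?_) a
  · simp [simplexVertex]
  · simp [simplexVertex, Pi.single_apply]

/-- The affine map carrying the standard simplices to `p` and `q` carries grid points to path
points. Edge vectors are rows, so its block diagonal linear part acts from the right. -/
lemma edgeMatrix_pathFacet (p : Fin (m + 1) → Fin m → ℝ) (q : Fin (n + 1) → Fin n → ℝ)
    (π : Fin (m + n + 1) → Fin (m + 1) × Fin (n + 1)) :
    edgeMatrix finSumFinEquiv (pathFacet p q π) =
      edgeMatrix finSumFinEquiv (fun t => gridVertex m n (π t)) *
        Matrix.fromBlocks (edgeMatrix (Equiv.refl _) p) 0 0 (edgeMatrix (Equiv.refl _) q) := by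
  ext i j
  rw [Matrix.mul_apply, Fintype.sum_sum_type]
  rcases j with j | j
  · have h1 := sum_simplexVertex_mul (π (finSumFinEquiv i).succ).1 fun a => p a j
    have h2 := sum_simplexVertex_mul (π 0).1 fun a => p a j
    simp only [edgeMatrix, pathFacet, gridVertex, Matrix.of_apply, Sum.elim_inl, Sum.elim_inr,
      Matrix.fromBlocks_apply₁₁, Matrix.fromBlocks_apply₂₁, Matrix.zero_apply, mul_zero,
      Finset.sum_const_zero, add_zero, Equiv.refl_apply, sub_mul, Finset.sum_sub_distrib, h1, h2]
    ring
  · have h1 := sum_simplexVertex_mul (π (finSumFinEquiv i).succ).2 fun a => q a j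
    have h2 := sum_simplexVertex_mul (π 0).2 fun a => q a j
    simp only [edgeMatrix, pathFacet, gridVertex, Matrix.of_apply, Sum.elim_inl, Sum.elim_inr,
      Matrix.fromBlocks_apply₁₂, Matrix.fromBlocks_apply₂₂, Matrix.zero_apply, mul_zero,
      Finset.sum_const_zero, zero_add, Equiv.refl_apply, sub_mul, Finset.sum_sub_distrib, h1, h2]
    ring

lemma edgeDet_pathFacet (p : Fin (m + 1) → Fin m → ℝ) (q : Fin (n + 1) → Fin n → ℝ)
    (π : Fin (m + n + 1) → Fin (m + 1) × Fin (n + 1)) :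
    edgeDet finSumFinEquiv (pathFacet p q π) =
      edgeDet finSumFinEquiv (fun t => gridVertex m n (π t)) *
        (edgeDet (Equiv.refl _) p * edgeDet (Equiv.refl _) q) := by
  have h := congrArg Matrix.det (edgeMatrix_pathFacet p q π)
  rw [Matrix.det_mul, Matrix.det_fromBlocks_zero₂₁] at h
  unfold edgeDet
  convert h

lemma simplexVertex_mem_latticePoints (a : Fin (m + 1)) :
    simplexVertex m a ∈ latticePoints (Fin m) := by
  refine Fin.cases ⟨0, ?_⟩ (fun i => ⟨Pi.single i 1, ?_⟩) a
  · ext j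
    simp [simplexVertex]
  · ext j
    simp [simplexVertex, Pi.single_apply]

/-- The signed number of staircases. -/
def staircaseCount (m n : ℕ) : ℤ :=
  ∑ᶠ π ∈ {π | IsStaircase m n π},
    oddSign (edgeDet finSumFinEquiv fun t => gridVertex m n (π t))

variable {K : Set (Finset (Fin m → ℝ))} {L : Set (Finset (Fin n → ℝ))}
  {P : Set (Fin m → ℝ)} {Q : Set (Fin n → ℝ)}
  {α : (Fin m → ℝ) → ℕ} {β : (Fin n → ℝ) → ℕ}
  {c₁ : (Fin m → ℝ) → Fin (m + 1)} {c₂ : (Fin n → ℝ) → Fin (n + 1)}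

lemma finsum_mem_prod_mul {X Y : Type*} {s : Set X} {t : Set Y} (hs : s.Finite) (ht : t.Finite)
    (f : X → ℤ) (g : Y → ℤ) :
    ∑ᶠ y ∈ s ×ˢ t, f y.1 * g y.2 = (∑ᶠ x ∈ s, f x) * ∑ᶠ y ∈ t, g y := by
  lift s to Finset X using hs
  lift t to Finset Y using ht
  rw [← Finset.coe_product, finsum_mem_coe_finset, finsum_mem_coe_finset, finsum_mem_coe_finset,
    Finset.sum_mul_sum, Finset.sum_product]

/-- All three determinants are integers, so `oddSign` splits over their product and the sum over
triples (staircase, facet, facet) factors. -/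
theorem signedCount_rankedProduct (hK : IsColoredTriangulation m K P c₁)
    (hL : IsColoredTriangulation n L Q c₂)
    (hα : IsColorRanking K c₁ α) (hβ : IsColorRanking L c₂ β) :
    signedCount finSumFinEquiv (rankedProduct K L α β) (sumColoring c₁ c₂) =
      staircaseCount m n * (signedCount (Equiv.refl _) K c₁ * signedCount (Equiv.refl _) L c₂) := by
  rw [staircaseCount, signedCount, signedCount, signedCount,
    ← finsum_mem_prod_mul hK.finite_coloredFacets hL.finite_coloredFacets,
    ← finsum_mem_prod_mul (Set.toFinite _)
      (hK.finite_coloredFacets.prod hL.finite_coloredFacets)]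
  symm
  refine finsum_mem_eq_of_bijOn _
    (bijOn_pathFacet hK.isComplex hL.isComplex hK.coloring hL.coloring hα hβ) ?_
  rintro ⟨π, p, q⟩ ⟨hπ, hp, hq⟩
  obtain ⟨a, ha⟩ := edgeDet_isInt finSumFinEquiv (fun t => gridVertex m n (π t)) fun t =>
    mem_latticePoints_iff.2
      ⟨simplexVertex_mem_latticePoints (π t).1, simplexVertex_mem_latticePoints (π t).2⟩
  obtain ⟨b, hb⟩ := hK.det_isInt (Equiv.refl _) hp
  obtain ⟨c, hc⟩ := hL.det_isInt (Equiv.refl _) hq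
  dsimp only
  rw [edgeDet_pathFacet, ha, hb, hc,
    ← Int.cast_mul b c, oddSign_mul, Int.cast_mul, oddSign_mul]

end Staircase

/-! ### The signature of the staircase triangulation -/

section StandardSimplex

variable {m n : ℕ}

lemma simplexVertex_injective (m : ℕ) : Function.Injective (simplexVertex m) := by
  intro a b
  refine Fin.cases ?_ (fun i => ?_) a <;> refine Fin.cases ?_ (fun j => ?_) b
  · exact fun _ => rfl
  · intro h
    have := congrFun h j
    simp [simplexVertex] at this
  · intro h
    have := congrFun h i
    simp [simplexVertex] at this
  · intro h
    have := congrFun h i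
    by_contra hne
    have hij : i ≠ j := fun h => hne (by rw [h])
    simp [simplexVertex, hij] at this

/-- The faces of the standard simplex. -/
def simplexFaces (m : ℕ) : Set (Finset (Fin m → ℝ)) :=
  {s | s.Nonempty ∧ s ⊆ valueFinset (simplexVertex m)}

/-- The coloring of the vertices of the standard simplex by their indices. -/
def simplexColor (m : ℕ) : (Fin m → ℝ) → Fin (m + 1) := Function.invFun (simplexVertex m)

lemma simplexColor_simplexVertex (a : Fin (m + 1)) : simplexColor m (simplexVertex m a) = a :=
  Function.leftInverse_invFun (simplexVertex_injective m) a

lemma valueFinset_simplexVertex_mem : valueFinset (simplexVertex m) ∈ simplexFaces m :=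
  ⟨⟨_, apply_mem_valueFinset _ 0⟩, fun _ h => h⟩

/-- The coordinates of the moment are the weights at the unit vectors, and the mass then gives the
weight at the origin. -/
lemma isComplex_simplexFaces (m : ℕ) : IsComplex (simplexFaces m) where
  nonempty s hs := hs.1
  down s hs t hts ht := ⟨ht, hts.trans hs.2⟩
  unique := by
    intro s hs t ht w w' hw hw' h0 h1
    rw [hw.total_eq hs.2, hw'.total_eq ht.2, sum_valueFinset (simplexVertex_injective m),
      sum_valueFinset (simplexVertex_injective m)] at h0
    rw [hw.sum_eq hs.2 fun v => v, hw'.sum_eq ht.2 fun v => v,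
      sum_valueFinset (simplexVertex_injective m),
      sum_valueFinset (simplexVertex_injective m)] at h1
    have hcoord : ∀ (u : (Fin m → ℝ) → ℝ) (k : Fin m),
        (∑ i, u (simplexVertex m i) • simplexVertex m i) k = u (simplexVertex m k.succ) := by
      intro u k
      rw [Finset.sum_apply, Fin.sum_univ_succ]
      simp [simplexVertex, Pi.single_apply]
    have hsucc : ∀ k : Fin m, w (simplexVertex m k.succ) = w' (simplexVertex m k.succ) := by
      intro k
      rw [← hcoord w, ← hcoord w', h1]
    rw [Fin.sum_univ_succ, Fin.sum_univ_succ, Finset.sum_congr rfl fun k _ => hsucc k,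
      add_left_inj] at h0
    funext v
    by_cases hv : v ∈ valueFinset (simplexVertex m)
    · obtain ⟨i, rfl⟩ := mem_valueFinset.1 hv
      exact Fin.cases h0 hsucc i
    · rw [hw.zero v fun h => hv (hs.2 h), hw'.zero v fun h => hv (ht.2 h)]

lemma vertices_simplexFaces : vertices (simplexFaces m) = Set.range (simplexVertex m) := by
  ext v
  simp [vertices, simplexFaces, mem_valueFinset]

lemma isColoredTriangulation_simplexFaces (m : ℕ) :
    IsColoredTriangulation m (simplexFaces m) (convexHull ℝ (Set.range (simplexVertex m)))
      (simplexColor m) where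
  triangulation := by
    refine isTriangulation_iff.2 ⟨?_, isComplex_simplexFaces m, fun x => ?_⟩
    · exact (valueFinset (simplexVertex m)).powerset.finite_toSet.subset fun s hs =>
        Finset.mem_coe.2 (Finset.mem_powerset.2 hs.2)
    · rw [← coe_valueFinset]
      exact ⟨fun h => ⟨_, valueFinset_simplexVertex_mem, h⟩,
        fun ⟨s, hs, h⟩ => convexHull_mono (Finset.coe_subset.2 hs.2) h⟩
  convex := convex_convexHull ℝ _
  interior_nonempty := by
    rw [interior_convexHull_nonempty_iff_affineSpan_eq_top, ← coe_valueFinset]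
    refine affineSpan_eq_top_of_card
      ((isComplex_simplexFaces m).unique.affineIndependent valueFinset_simplexVertex_mem) ?_
    rw [card_valueFinset (simplexVertex_injective m), Fintype.card_fin]
  lattice := by
    rw [vertices_simplexFaces]
    rintro _ ⟨a, rfl⟩
    exact simplexVertex_mem_latticePoints a
  coloring := by
    intro s hs x hx y hy hxy
    obtain ⟨i, rfl⟩ := mem_valueFinset.1 (hs.2 hx)
    obtain ⟨j, rfl⟩ := mem_valueFinset.1 (hs.2 hy)
    rw [simplexColor_simplexVertex, simplexColor_simplexVertex] at hxy
    rw [hxy]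

lemma isColorRanking_simplexFaces (m : ℕ) :
    IsColorRanking (simplexFaces m) (simplexColor m) fun v => (simplexColor m v : ℕ) where
  injOn := by
    rw [vertices_simplexFaces]
    rintro _ ⟨i, rfl⟩ _ ⟨j, rfl⟩ h
    have := Fin.ext h
    rw [simplexColor_simplexVertex, simplexColor_simplexVertex] at this
    rw [this]
  monotone v _ w _ h := Fin.le_def.2 h

lemma simplexVertex_mem_coloredFacets :
    simplexVertex m ∈ coloredFacets (simplexFaces m) (simplexColor m) :=
  ⟨valueFinset_simplexVertex_mem, simplexColor_simplexVertex⟩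

lemma coloredFacets_simplexFaces :
    coloredFacets (simplexFaces m) (simplexColor m) = {simplexVertex m} := by
  refine Set.eq_singleton_iff_unique_mem.2 ⟨simplexVertex_mem_coloredFacets, fun p hp => ?_⟩
  funext i
  obtain ⟨j, hj⟩ := mem_valueFinset.1 (hp.1.2 (apply_mem_valueFinset p i))
  have := hp.2 i
  rw [← hj, simplexColor_simplexVertex] at this
  rw [← hj, this]

lemma signedCount_simplexFaces :
    signedCount (Equiv.refl (Fin m)) (simplexFaces m) (simplexColor m) = 1 := by
  have h1 : edgeMatrix (Equiv.refl (Fin m)) (simplexVertex m) = 1 := by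
    ext i j
    simp [edgeMatrix, simplexVertex, Matrix.one_apply, Pi.single_apply, eq_comm]
  have h2 : edgeDet (Equiv.refl (Fin m)) (simplexVertex m) = 1 := by
    have h := congrArg Matrix.det h1
    rw [Matrix.det_one] at h
    unfold edgeDet
    convert h
  rw [signedCount, coloredFacets_simplexFaces, finsum_mem_singleton, h2]
  simpa using oddSign_intCast 1

/-- Each standard simplex has a single colored facet, so every facet of this product comes from a
staircase alone. The results on simplicial products thus apply to the staircase triangulation. -/
lemma staircaseTriangulation_eq (m n : ℕ) :
    staircaseTriangulation m n = rankedProduct (simplexFaces m) (simplexFaces n)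
      (fun v => (simplexColor m v : ℕ)) fun v => (simplexColor n v : ℕ) := by
  have hm := isColoredTriangulation_simplexFaces m
  have hn := isColoredTriangulation_simplexFaces n
  have hprod := hm.rankedProduct hn (isColorRanking_simplexFaces m) (isColorRanking_simplexFaces n)
  have hpath : ∀ π, (Finset.univ.image fun t => gridVertex m n (π t)) =
      valueFinset (pathFacet (simplexVertex m) (simplexVertex n) π) := by
    intro π
    ext v
    rw [mem_valueFinset]
    simp [pathFacet, gridVertex]
  ext s
  constructor
  · rintro ⟨hs, π, hπ, hsub⟩
    rw [hpath] at hsub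
    exact rankedProduct_down hm.isComplex hn.isComplex
      (pathFacet_mem hm.isComplex hn.isComplex (isColorRanking_simplexFaces m)
        (isColorRanking_simplexFaces n) simplexVertex_mem_coloredFacets
        simplexVertex_mem_coloredFacets hπ).1 hsub hs
  · intro hs
    obtain ⟨t, ht, hst⟩ := exists_isFacet_superset hprod.finite hs
    obtain ⟨z, hz, rfl⟩ := hprod.exists_coloredFacet finSumFinEquiv ht
    obtain ⟨p, hp, q, hq, π, hπ, rfl⟩ := exists_pathFacet hm.isComplex hn.isComplex hm.coloring
      hn.coloring (isColorRanking_simplexFaces m) (isColorRanking_simplexFaces n) hz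
    rw [coloredFacets_simplexFaces, Set.mem_singleton_iff] at hp hq
    subst hp hq
    refine ⟨hprod.isComplex.nonempty s hs, π, hπ, ?_⟩
    rwa [hpath]

theorem staircaseSignature_eq (m n : ℕ) : staircaseSignature m n = (staircaseCount m n).natAbs := by
  have hm := isColoredTriangulation_simplexFaces m
  have hn := isColoredTriangulation_simplexFaces n
  have hprod := hm.rankedProduct hn (isColorRanking_simplexFaces m) (isColorRanking_simplexFaces n)
  rw [staircaseSignature, staircaseTriangulation_eq, hprod.signature_eq finSumFinEquiv,
    signedCount_rankedProduct hm hn (isColorRanking_simplexFaces m) (isColorRanking_simplexFaces n),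
    signedCount_simplexFaces, signedCount_simplexFaces, mul_one, mul_one]

/-- The signature of a simplicial product. -/
theorem signature_rankedProduct {K : Set (Finset (Fin m → ℝ))} {L : Set (Finset (Fin n → ℝ))}
    {P : Set (Fin m → ℝ)} {Q : Set (Fin n → ℝ)} {α : (Fin m → ℝ) → ℕ} {β : (Fin n → ℝ) → ℕ}
    {c₁ : (Fin m → ℝ) → Fin (m + 1)} {c₂ : (Fin n → ℝ) → Fin (n + 1)}
    (hK : IsColoredTriangulation m K P c₁) (hL : IsColoredTriangulation n L Q c₂)
    (hα : IsColorRanking K c₁ α) (hβ : IsColorRanking L c₂ β) :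
    signature (rankedProduct K L α β) = staircaseSignature m n * signature K * signature L := by
  rw [(hK.rankedProduct hL hα hβ).signature_eq finSumFinEquiv,
    signedCount_rankedProduct hK hL hα hβ, hK.signature_eq (Equiv.refl _),
    hL.signature_eq (Equiv.refl _), staircaseSignature_eq, Int.natAbs_mul, Int.natAbs_mul,
    mul_assoc]

end StandardSimplex

/-! ### Regularity -/

section Potential

/-- A supermodular function of a pair of ranks: the number of pairs of thresholds below them. -/
def thresholdCount (N a b : ℕ) : ℝ :=
  ∑ i ∈ Finset.range N, ∑ j ∈ Finset.range N, if i ≤ a ∧ j ≤ b then 1 else 0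

/-- Optimal dual potentials for a finite chain of ranks. -/
lemma exists_potential (S : Finset (ℕ × ℕ))
    (hS : ∀ x ∈ S, ∀ y ∈ S, (x.1 ≤ y.1 ∧ x.2 ≤ y.2) ∨ (y.1 ≤ x.1 ∧ y.2 ≤ x.2)) {N : ℕ}
    (hN : ∀ x ∈ S, x.1 < N ∧ x.2 < N) :
    ∃ f g : ℕ → ℝ, ∀ a b, (∃ b', (a, b') ∈ S) → (∃ a', (a', b) ∈ S) →
      thresholdCount N a b ≤ f a + g b ∧ (thresholdCount N a b = f a + g b ↔ (a, b) ∈ S) := by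
  -- `thresholdCount` is a sum of indicators of `i ≤ a ∧ j ≤ b`, and each is treated separately. On
  -- the chain, one of the two threshold conditions implies the other, so the indicator equals that
  -- of the stronger condition. The coefficient `c i j` selects it; when the conditions are
  -- equivalent on `S`, the value 1/2 leaves both parts available for strictness.
  let c : ℕ → ℕ → ℝ := fun i j =>
    if ∀ x ∈ S, i ≤ x.1 → j ≤ x.2 then (if ∀ x ∈ S, j ≤ x.2 → i ≤ x.1 then 1 / 2 else 1) else 0
  have hc0 : ∀ i j, 0 ≤ c i j := fun i j => by
    simp only [c]
    split_ifs <;> norm_num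
  have hc1 : ∀ i j, c i j ≤ 1 := fun i j => by
    simp only [c]
    split_ifs <;> norm_num
  let T : ℕ → ℕ → ℕ → ℕ → ℝ := fun i j a b =>
    c i j * (if i ≤ a then 1 else 0) + (1 - c i j) * (if j ≤ b then 1 else 0)
  have hT : ∀ i j a b, (if i ≤ a ∧ j ≤ b then (1 : ℝ) else 0) ≤ T i j a b := by
    intro i j a b
    have h0 := hc0 i j
    have h1 := hc1 i j
    by_cases ha : i ≤ a <;> by_cases hb : j ≤ b <;> simp [T, ha, hb, h0, h1]
  have hTS : ∀ x ∈ S, ∀ i j, (if i ≤ x.1 ∧ j ≤ x.2 then (1 : ℝ) else 0) = T i j x.1 x.2 := by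
    intro x hx i j
    by_cases h1 : ∀ x ∈ S, i ≤ x.1 → j ≤ x.2
    · by_cases h2 : ∀ x ∈ S, j ≤ x.2 → i ≤ x.1
      · have hiff : i ≤ x.1 ↔ j ≤ x.2 := ⟨h1 x hx, h2 x hx⟩
        simp only [T, c, if_pos h1, if_pos h2, hiff, and_self]
        ring
      · have hiff : i ≤ x.1 ∧ j ≤ x.2 ↔ i ≤ x.1 := ⟨fun h => h.1, fun h => ⟨h, h1 x hx h⟩⟩
        simp only [T, c, if_pos h1, if_neg h2, hiff]
        ring
    · have h2 : ∀ x ∈ S, j ≤ x.2 → i ≤ x.1 := by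
        push Not at h1
        obtain ⟨y, hy, hiy, hjy⟩ := h1
        intro z hz hjz
        rcases hS y hy z hz with h | h <;> omega
      have hiff : i ≤ x.1 ∧ j ≤ x.2 ↔ j ≤ x.2 := ⟨fun h => h.2, fun h => ⟨h2 x hx h, h⟩⟩
      simp only [T, c, if_neg h1, hiff]
      ring
  have hTlt : ∀ a b, (∃ b', (a, b') ∈ S) → (∃ a', (a', b) ∈ S) → (a, b) ∉ S →
      ∃ i < N, ∃ j < N, (if i ≤ a ∧ j ≤ b then (1 : ℝ) else 0) < T i j a b := by
    rintro a b ha hb hab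
    -- The lowest point `(a, b')` of `S` in column `a` and the leftmost point `(a', b)` in row `b`
    -- are comparable. Their coordinatewise maximum gives a threshold pair at which the bound is
    -- strict; minimality ensures that the coefficient there has the right value.
    have ha' := Nat.find_spec ha
    have hb' := Nat.find_spec hb
    have hamin : ∀ k, (a, k) ∈ S → Nat.find ha ≤ k := fun k hk => Nat.find_min' ha hk
    have hbmin : ∀ k, (k, b) ∈ S → Nat.find hb ≤ k := fun k hk => Nat.find_min' hb hk
    generalize Nat.find ha = b' at ha' hamin
    generalize Nat.find hb = a' at hb' hbmin
    have hbb : b' ≠ b := by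
      rintro rfl
      exact hab ha'
    have haa : a' ≠ a := by
      rintro rfl
      exact hab hb'
    rcases hS _ ha' _ hb' with ⟨h1, h2⟩ | ⟨h1, h2⟩
    · dsimp only at h1 h2
      refine ⟨a', (hN _ hb').1, b, (hN _ hb').2, ?_⟩
      have hcond : ∀ x ∈ S, b ≤ x.2 → a' ≤ x.1 := by
        intro x hx hbx
        by_contra! hlt
        rcases hS x hx _ hb' with ⟨h3, h4⟩ | ⟨h3, h4⟩
        · have hx2 : x.2 = b := le_antisymm h4 hbx
          have := hbmin x.1 (by rw [← hx2]; exact hx)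
          omega
        · dsimp only at h3
          omega
      have hna : ¬ a' ≤ a := by omega
      have hcc : c a' b < 1 := by
        simp only [c, if_pos hcond]
        split_ifs <;> norm_num
      simp [T, hna, hcc]
    · dsimp only at h1 h2
      refine ⟨a, (hN _ ha').1, b', (hN _ ha').2, ?_⟩
      have hcond : ∀ x ∈ S, a ≤ x.1 → b' ≤ x.2 := by
        intro x hx hax
        by_contra! hlt
        rcases hS x hx _ ha' with ⟨h3, h4⟩ | ⟨h3, h4⟩
        · have hx1 : x.1 = a := le_antisymm h3 hax
          have := hamin x.2 (by rw [← hx1]; exact hx)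
          omega
        · dsimp only at h4
          omega
      have hnb : ¬ b' ≤ b := by omega
      have hcc : 0 < c a b' := by
        simp only [c, if_pos hcond]
        split_ifs <;> norm_num
      simp [T, hnb, hcc]
  refine ⟨fun a => ∑ i ∈ Finset.range N, ∑ j ∈ Finset.range N, c i j * (if i ≤ a then 1 else 0),
    fun b => ∑ i ∈ Finset.range N, ∑ j ∈ Finset.range N, (1 - c i j) * (if j ≤ b then 1 else 0), ?_⟩
  intro a b ha hb
  have hsum : (∑ i ∈ Finset.range N, ∑ j ∈ Finset.range N, c i j * (if i ≤ a then (1 : ℝ) else 0)) +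
      ∑ i ∈ Finset.range N, ∑ j ∈ Finset.range N, (1 - c i j) * (if j ≤ b then (1 : ℝ) else 0) =
      ∑ i ∈ Finset.range N, ∑ j ∈ Finset.range N, T i j a b := by
    simp only [T, Finset.sum_add_distrib]
  dsimp only
  rw [hsum]
  refine ⟨Finset.sum_le_sum fun i _ => Finset.sum_le_sum fun j _ => hT i j a b, fun heq => ?_,
    fun hab => Finset.sum_congr rfl fun i _ => Finset.sum_congr rfl fun j _ => hTS _ hab i j⟩
  by_contra hab
  obtain ⟨i, hi, j, hj, hlt⟩ := hTlt a b ha hb hab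
  refine heq.not_lt (Finset.sum_lt_sum (fun i _ => Finset.sum_le_sum fun j _ => hT i j a b)
    ⟨i, Finset.mem_range.2 hi, Finset.sum_lt_sum (fun j _ => hT i j a b)
      ⟨j, Finset.mem_range.2 hj, hlt⟩⟩)

end Potential

/-! ### Lower cells and convex lifting functions -/

section LowerCells

variable {ι : Type*} {K : Set (Finset (ι → ℝ))} {P : Set (ι → ℝ)}

lemma affineMap_sum (l : (ι → ℝ) →ᵃ[ℝ] ℝ) {s : Finset (ι → ℝ)} {w : (ι → ℝ) → ℝ}
    (hw : ∑ v ∈ s, w v = 1) : l (∑ v ∈ s, w v • v) = ∑ v ∈ s, w v * l v := by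
  have h : ∀ v, l v = l.linear v + l 0 := fun v => congrFun l.decomp v
  rw [h, map_sum]
  conv_rhs => rw [Finset.sum_congr rfl fun v _ => by rw [h v, mul_add]]
  rw [Finset.sum_add_distrib, ← Finset.sum_mul, hw, one_mul]
  simp

/-- A function whose lower cells include all faces of a triangulation induces the triangulation. -/
lemma IsTriangulation.eq_lowerCells (hK : IsTriangulation K P) (hP : Convex ℝ P)
    {h : (ι → ℝ) → ℝ} (hsub : K ⊆ lowerCells (vertices K) h) : K = lowerCells (vertices K) h := by
  obtain ⟨hf, hC, hcov⟩ := isTriangulation_iff.1 hK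
  refine hsub.antisymm ?_
  rintro s ⟨hs, l, hl, hls⟩
  obtain ⟨w, hw, hpos, hw1⟩ := exists_pos_weight hs
  have hxP : ∑ v ∈ s, w v • v ∈ P := by
    refine hP.sum_mem (fun v _ => hw.nonneg v) hw1 fun v hv => ?_
    exact (hcov v).2 ⟨{v}, ((hls v).1 hv).1, by simp⟩
  obtain ⟨t, ht, hxt⟩ := (hcov _).1 hxP
  obtain ⟨u, hu, hu1, hux⟩ := mem_convexHull_iff_weight.1 hxt
  -- Passing to the support makes all weights positive, so that equality of weighted sums gives
  -- equality at each vertex.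
  set t' := t.filter fun v => u v ≠ 0 with ht'
  have hut' : IsWeight t' u := ⟨hu.nonneg, fun v hv => by
    by_contra hne
    refine hv (Finset.mem_filter.2 ⟨?_, hne⟩)
    by_contra hvt
    exact hne (hu.zero v hvt)⟩
  have hsub' : t' ⊆ t := Finset.filter_subset _ _
  have hupos : ∀ v ∈ t', 0 < u v := fun v hv =>
    lt_of_le_of_ne (hu.nonneg v) (Finset.mem_filter.1 hv).2.symm
  rw [← hut'.total_eq hsub'] at hu1
  rw [← hut'.sum_eq hsub' fun v => v] at hux
  have ht'ne : t'.Nonempty := by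
    rw [Finset.nonempty_iff_ne_empty]
    intro hempty
    rw [hempty] at hu1
    simp at hu1
  have ht'K : t' ∈ K := hC.down t ht t' hsub' ht'ne
  obtain ⟨-, l', hl', hlt'⟩ := hsub ht'K
  have e1 : l (∑ v ∈ s, w v • v) = ∑ v ∈ s, w v * h v := by
    rw [affineMap_sum l hw1]
    exact Finset.sum_congr rfl fun v hv => by rw [((hls v).1 hv).2]
  have e2 : l (∑ v ∈ s, w v • v) = ∑ v ∈ t', u v * l v := by
    rw [← hux, affineMap_sum l hu1]
  have e3 : l' (∑ v ∈ s, w v • v) = ∑ v ∈ t', u v * h v := by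
    rw [← hux, affineMap_sum l' hu1]
    exact Finset.sum_congr rfl fun v hv => by rw [((hlt' v).1 hv).2]
  have e4 : l' (∑ v ∈ s, w v • v) = ∑ v ∈ s, w v * l' v := affineMap_sum l' hw1
  have i1 : ∀ v ∈ t', u v * l v ≤ u v * h v := fun v hv =>
    mul_le_mul_of_nonneg_left (hl v ((hlt' v).1 hv).1) (hu.nonneg v)
  have i2 : ∀ v ∈ s, w v * l' v ≤ w v * h v := fun v hv =>
    mul_le_mul_of_nonneg_left (hl' v ((hls v).1 hv).1) (hw.nonneg v)
  have j1 := Finset.sum_le_sum i1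
  have j2 := Finset.sum_le_sum i2
  -- At the barycenter of `s`, the bound for `l` over `t'` gives `l ≤ l'` and the bound for `l'`
  -- over `s` gives `l' ≤ l`. Equality holds throughout, so each supporting function touches the
  -- lift at the vertices of the other cell.
  have hst : s = t' := by
    ext v
    constructor
    · intro hv
      refine (hlt' v).2 ⟨((hls v).1 hv).1, ?_⟩
      have := (Finset.sum_eq_sum_iff_of_le i2).1 (by linarith) v hv
      exact mul_left_cancel₀ (hpos v hv).ne' this
    · intro hv
      refine (hls v).2 ⟨((hlt' v).1 hv).1, ?_⟩
      have := (Finset.sum_eq_sum_iff_of_le i1).1 (by linarith) v hv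
      exact mul_left_cancel₀ (hupos v hv).ne' this
  rw [hst]
  exact ht'K

lemma lowerCells_congr {V : Set (ι → ℝ)} {h h' : (ι → ℝ) → ℝ} (hV : ∀ v ∈ V, h v = h' v) :
    lowerCells V h = lowerCells V h' := by
  ext s
  refine and_congr_right fun _ => exists_congr fun l => and_congr ?_ ?_
  · exact forall₂_congr fun v hv => by rw [hV v hv]
  · exact forall_congr' fun v => iff_congr Iff.rfl (and_congr_right fun hv => by rw [hV v hv])

/-- A subdivision induced by an arbitrary function on its vertices is induced by a convex
function. -/
lemma isRegular_of_eq_lowerCells (hf : K.Finite) {h : (ι → ℝ) → ℝ}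
    (hK : K = lowerCells (vertices K) h) : IsRegular K := by
  have hmem : ∀ s : K, ∃ l : (ι → ℝ) →ᵃ[ℝ] ℝ, (∀ v ∈ vertices K, l v ≤ h v) ∧
      ∀ v, v ∈ s.1 ↔ v ∈ vertices K ∧ l v = h v := by
    rintro ⟨s, hs⟩
    rw [hK] at hs
    exact hs.2
  choose l hl hls using hmem
  have := hf.to_subtype
  by_cases hne : Nonempty K
  · have hbdd : ∀ x, BddAbove (Set.range fun s => l s x) := fun x => (Set.finite_range _).bddAbove
    -- The maximum of the supporting functions is convex and lies below `h` on the vertices. It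
    -- attains `h v` there because `{v}` is itself a cell.
    refine ⟨fun x => ⨆ s, l s x, ⟨convex_univ, ?_⟩, ?_⟩
    · intro x _ y _ a b ha hb hab
      refine ciSup_le fun s => ?_
      have : l s (a • x + b • y) = a * l s x + b * l s y := Convex.combo_affine_apply hab
      rw [this]
      exact add_le_add (mul_le_mul_of_nonneg_left (le_ciSup (hbdd x) s) ha)
        (mul_le_mul_of_nonneg_left (le_ciSup (hbdd y) s) hb)
    · refine hK.trans (lowerCells_congr fun v hv => le_antisymm ?_ (ciSup_le fun s => hl s v hv))
      have h1 := ((hls ⟨{v}, hv⟩ v).1 (Finset.mem_singleton_self v)).2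
      rw [← h1]
      exact le_ciSup (hbdd v) _
  · refine ⟨fun _ => 0, convexOn_const 0 convex_univ, hK.trans (lowerCells_congr fun v hv => ?_)⟩
    exact absurd ⟨⟨{v}, hv⟩⟩ hne

/-- Values at the vertices of a simplex are interpolated by an affine function. -/
lemma exists_affineMap_eq {s : Finset (ι → ℝ)} (hs : AffineIndependent ℝ ((↑) : s → ι → ℝ))
    (f : (ι → ℝ) → ℝ) : ∃ l : (ι → ℝ) →ᵃ[ℝ] ℝ, ∀ v ∈ s, l v = f v := by
  -- Homogenization: affine independence becomes linear independence after appending a coordinate 1,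
  -- and a linear extension restricts to the desired affine map.
  have hli : LinearIndependent ℝ fun v : s => ((v : ι → ℝ), (1 : ℝ)) := by
    rw [Fintype.linearIndependent_iff]
    intro g hg
    have h1 := congrArg Prod.fst hg
    have h2 := congrArg Prod.snd hg
    rw [Prod.fst_sum] at h1
    rw [Prod.snd_sum] at h2
    simp only [Prod.smul_mk, smul_eq_mul, mul_one, Prod.fst_zero, Prod.snd_zero] at h1 h2
    intro i
    exact affineIndependent_iff.1 hs Finset.univ g h2 h1 i (Finset.mem_univ i)
  obtain ⟨L, hL⟩ := LinearMap.exists_extend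
    ((Finsupp.linearCombination ℝ fun v : s => f v).comp hli.repr)
  refine ⟨(L.comp (LinearMap.inl ℝ (ι → ℝ) ℝ)).toAffineMap +
    AffineMap.const ℝ (ι → ℝ) (L (0, 1)), fun v hv => ?_⟩
  have hmem : (v, (1 : ℝ)) ∈ Submodule.span ℝ (Set.range fun v : s => ((v : ι → ℝ), (1 : ℝ))) :=
    Submodule.subset_span ⟨⟨v, hv⟩, rfl⟩
  have h1 := LinearMap.congr_fun hL ⟨_, hmem⟩
  simp only [LinearMap.comp_apply, Submodule.subtype_apply] at h1
  rw [hli.repr_eq_single ⟨v, hv⟩ _ rfl, Finsupp.linearCombination_single, one_smul] at h1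
  rw [← h1]
  simp only [AffineMap.coe_add, Pi.add_apply, LinearMap.coe_toAffineMap, LinearMap.comp_apply,
    LinearMap.inl_apply, AffineMap.const_apply]
  rw [← map_add]
  simp

end LowerCells

/-! ### Regularity of the simplicial product -/

section RegularProduct

variable {ι κ : Type*} {K : Set (Finset (ι → ℝ))} {L : Set (Finset (κ → ℝ))}
  {P : Set (ι → ℝ)} {Q : Set (κ → ℝ)} {α : (ι → ℝ) → ℕ} {β : (κ → ℝ) → ℕ}

/-- The faces of the simplicial product are lower cells of small perturbations of the sum of the
lifting functions. -/
lemma eventually_mem_lowerCells (hK : IsTriangulation K P) (hL : IsTriangulation L Q)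
    (hα : Set.InjOn α (vertices K)) (hβ : Set.InjOn β (vertices L))
    {lam : (ι → ℝ) → ℝ} {mu : (κ → ℝ) → ℝ} (hlam : K = lowerCells (vertices K) lam)
    (hmu : L = lowerCells (vertices L) mu) {N : ℕ} (hNα : ∀ v ∈ vertices K, α v < N)
    (hNβ : ∀ v ∈ vertices L, β v < N) {S : Finset (ι ⊕ κ → ℝ)} (hS : S ∈ rankedProduct K L α β) :
    ∀ᶠ e in nhdsWithin (0 : ℝ) (Set.Ioi 0), S ∈ lowerCells (vertices (rankedProduct K L α β))
      fun z => lam (fstPoint z) + mu (sndPoint z) -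
        e * thresholdCount N (α (fstPoint z)) (β (sndPoint z)) := by
  have hKC := (isTriangulation_iff.1 hK).2.1
  have hLC := (isTriangulation_iff.1 hL).2.1
  have hprod := isTriangulation_rankedProduct hK hL hα hβ
  have hv1 := fun z hz => fstPoint_mem_vertices hKC hS (z := z) hz
  have hv2 := fun z hz => sndPoint_mem_vertices hLC hS (z := z) hz
  have h1 := hS.1
  have h2 := hS.2.1
  rw [hlam] at h1
  rw [hmu] at h2
  obtain ⟨-, l₁, hl₁, hl₁S⟩ := h1
  obtain ⟨-, l₂, hl₂, hl₂S⟩ := h2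
  obtain ⟨f, g, hfg⟩ := exists_potential
    (S.image fun z => (α (fstPoint z), β (sndPoint z))) (N := N) (by
      intro x hx y hy
      obtain ⟨x, hxS, rfl⟩ := Finset.mem_image.1 hx
      obtain ⟨y, hyS, rfl⟩ := Finset.mem_image.1 hy
      exact hS.2.2 x hxS y hyS) (by
      intro x hx
      obtain ⟨x, hxS, rfl⟩ := Finset.mem_image.1 hx
      exact ⟨hNα _ (hv1 x hxS), hNβ _ (hv2 x hxS)⟩)
  -- The potentials depend only on ranks; interpolating them affinely on the two projected faces
  -- allows them to tilt the supporting functions `l₁` and `l₂`.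
  obtain ⟨ψ₁, hψ₁⟩ := exists_affineMap_eq (hKC.unique.affineIndependent hS.1) fun v => f (α v)
  obtain ⟨ψ₂, hψ₂⟩ := exists_affineMap_eq (hLC.unique.affineIndependent hS.2.1) fun v => g (β v)
  have hface : ∀ z, fstPoint z ∈ fstFace S → sndPoint z ∈ sndFace S →
      thresholdCount N (α (fstPoint z)) (β (sndPoint z)) ≤ ψ₁ (fstPoint z) + ψ₂ (sndPoint z) ∧
      (thresholdCount N (α (fstPoint z)) (β (sndPoint z)) = ψ₁ (fstPoint z) + ψ₂ (sndPoint z) ↔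
        z ∈ S) := by
    intro z hz1 hz2
    rw [hψ₁ _ hz1, hψ₂ _ hz2]
    obtain ⟨x, hx, hxz⟩ := mem_fstFace.1 hz1
    obtain ⟨y, hy, hyz⟩ := mem_sndFace.1 hz2
    obtain ⟨h3, h4⟩ := hfg (α (fstPoint z)) (β (sndPoint z))
      ⟨β (sndPoint x), Finset.mem_image.2 ⟨x, hx, by rw [hxz]⟩⟩
      ⟨α (fstPoint y), Finset.mem_image.2 ⟨y, hy, by rw [hyz]⟩⟩
    refine ⟨h3, h4.trans ⟨fun h => ?_, fun h => Finset.mem_image.2 ⟨z, h, rfl⟩⟩⟩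
    obtain ⟨u, hu, huz⟩ := Finset.mem_image.1 h
    obtain ⟨h5, h6⟩ := Prod.ext_iff.1 huz
    have : u = z := point_ext (hα (hv1 u hu) (hxz ▸ hv1 x hx) h5)
      (hβ (hv2 u hu) (hyz ▸ hv2 y hy) h6)
    exact this ▸ hu
  -- Outside the product of the projected faces the unperturbed gap is already positive, and only
  -- finitely many vertices have to keep it for small `e`. Inside that product the unperturbed gap
  -- is zero and `hface` decides.
  have hgap : ∀ᶠ e in nhdsWithin (0 : ℝ) (Set.Ioi 0), ∀ z ∈ vertices (rankedProduct K L α β),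
      ¬ (fstPoint z ∈ fstFace S ∧ sndPoint z ∈ sndFace S) →
      0 < (lam (fstPoint z) - l₁ (fstPoint z)) + (mu (sndPoint z) - l₂ (sndPoint z)) +
        e * (ψ₁ (fstPoint z) + ψ₂ (sndPoint z) -
          thresholdCount N (α (fstPoint z)) (β (sndPoint z))) := by
    refine (Filter.eventually_all_finite (finite_vertices hprod.1)).2 fun z hz => ?_
    rw [vertices_rankedProduct] at hz
    by_cases hzS : fstPoint z ∈ fstFace S ∧ sndPoint z ∈ sndFace S
    · exact Filter.Eventually.of_forall fun e h => absurd hzS h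
    · have hpos : 0 < (lam (fstPoint z) - l₁ (fstPoint z)) + (mu (sndPoint z) - l₂ (sndPoint z)) := by
        have h3 := hl₁ _ hz.1
        have h4 := hl₂ _ hz.2
        by_contra! hcon
        exact hzS ⟨(hl₁S _).2 ⟨hz.1, by linarith⟩, (hl₂S _).2 ⟨hz.2, by linarith⟩⟩
      have hcont : Continuous fun e : ℝ =>
          (lam (fstPoint z) - l₁ (fstPoint z)) + (mu (sndPoint z) - l₂ (sndPoint z)) +
            e * (ψ₁ (fstPoint z) + ψ₂ (sndPoint z) -
              thresholdCount N (α (fstPoint z)) (β (sndPoint z))) := by fun_prop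
      have hev := hcont.continuousAt.eventually_mem (x := 0)
        (Ioi_mem_nhds (a := (0 : ℝ)) (by simpa using hpos))
      exact (hev.filter_mono nhdsWithin_le_nhds).mono fun e he _ => he
  filter_upwards [hgap, self_mem_nhdsWithin] with e he hepos
  have hepos : 0 < e := hepos
  refine ⟨(isComplex_rankedProduct hKC hLC hα hβ).nonempty S hS, ?_⟩
  let l : (ι ⊕ κ → ℝ) →ᵃ[ℝ] ℝ :=
    (l₁ - e • ψ₁).comp (LinearMap.funLeft ℝ ℝ (Sum.inl : ι → ι ⊕ κ)).toAffineMap +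
      (l₂ - e • ψ₂).comp (LinearMap.funLeft ℝ ℝ (Sum.inr : κ → ι ⊕ κ)).toAffineMap
  have hl : ∀ z, l z = l₁ (fstPoint z) - e * ψ₁ (fstPoint z) +
      (l₂ (sndPoint z) - e * ψ₂ (sndPoint z)) := fun z => rfl
  have hcases : ∀ z ∈ vertices (rankedProduct K L α β),
      l z ≤ lam (fstPoint z) + mu (sndPoint z) -
        e * thresholdCount N (α (fstPoint z)) (β (sndPoint z)) ∧
      (l z = lam (fstPoint z) + mu (sndPoint z) -
        e * thresholdCount N (α (fstPoint z)) (β (sndPoint z)) ↔ z ∈ S) := by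
    intro z hz
    rw [hl]
    by_cases hzS : fstPoint z ∈ fstFace S ∧ sndPoint z ∈ sndFace S
    · obtain ⟨h3, h4⟩ := hface z hzS.1 hzS.2
      have h5 := ((hl₁S _).1 hzS.1).2
      have h6 := ((hl₂S _).1 hzS.2).2
      have h7 := mul_le_mul_of_nonneg_left h3 hepos.le
      refine ⟨by rw [h5, h6]; linarith, ?_⟩
      rw [← h4, h5, h6]
      constructor
      · intro h
        exact mul_left_cancel₀ hepos.ne' (by linarith)
      · intro h
        rw [h]
        ring
    · have h3 := he z hz hzS
      refine ⟨by linarith, fun h => by linarith, fun h => ?_⟩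
      exact absurd ⟨fstPoint_mem_fstFace h, sndPoint_mem_sndFace h⟩ hzS
  refine ⟨l, fun z hz => (hcases z hz).1, fun z => ⟨fun hz => ?_, fun hz => (hcases z hz.1).2.1 hz.2⟩⟩
  have hzv := (isComplex_rankedProduct hKC hLC hα hβ).mem_vertices hS hz
  exact ⟨hzv, (hcases z hzv).2.2 hz⟩

/-- There are finitely many faces, so one positive `e` serves all of them at once. -/
theorem isRegular_rankedProduct (hK : IsTriangulation K P) (hL : IsTriangulation L Q)
    (hP : Convex ℝ P) (hQ : Convex ℝ Q)
    (hα : Set.InjOn α (vertices K)) (hβ : Set.InjOn β (vertices L))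
    (hKr : IsRegular K) (hLr : IsRegular L) : IsRegular (rankedProduct K L α β) := by
  obtain ⟨lam, -, hlam⟩ := hKr
  obtain ⟨mu, -, hmu⟩ := hLr
  have hprod := isTriangulation_rankedProduct hK hL hα hβ
  obtain ⟨N₁, hN₁⟩ := ((finite_vertices hK.1).image α).bddAbove
  obtain ⟨N₂, hN₂⟩ := ((finite_vertices hL.1).image β).bddAbove
  have hev := (Filter.eventually_all_finite hprod.1).2 fun S hS =>
    eventually_mem_lowerCells hK hL hα hβ hlam hmu (N := N₁ + N₂ + 1)
      (fun v hv => by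
        have := hN₁ (Set.mem_image_of_mem α hv)
        omega)
      (fun v hv => by
        have := hN₂ (Set.mem_image_of_mem β hv)
        omega) hS
  obtain ⟨e, he⟩ := hev.exists
  exact isRegular_of_eq_lowerCells hprod.1
    (hprod.eq_lowerCells (convex_productSet hP hQ) fun S hS => he S hS)

end RegularProduct

/-! ### Products of lattice polytopes and of vertex orderings -/

section Main

lemma IsLatticePolytope.convex {ι : Type*} {P : Set (ι → ℝ)} (hP : IsLatticePolytope P) :
    Convex ℝ P := by
  obtain ⟨⟨S, rfl⟩, -⟩ := hP
  exact convex_convexHull ℝ _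

lemma IsLatticePolytope.interior_nonempty {ι : Type*} [Fintype ι] {P : Set (ι → ℝ)}
    (hP : IsLatticePolytope P) : (interior P).Nonempty :=
  hP.convex.interior_nonempty_iff_affineSpan_eq_top.2 hP.2

lemma productSet_eq_preimage {ι κ : Type*} (P : Set (ι → ℝ)) (Q : Set (κ → ℝ)) :
    productSet P Q = (LinearEquiv.sumArrowLequivProdArrow ι κ ℝ ℝ).symm '' (P ×ˢ Q) := by
  rw [LinearEquiv.image_symm_eq_preimage]
  rfl

lemma isLatticePolytope_productSet {ι κ : Type*} [Fintype ι] [Fintype κ] {P : Set (ι → ℝ)}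
    {Q : Set (κ → ℝ)} (hP : IsLatticePolytope P) (hQ : IsLatticePolytope Q) :
    IsLatticePolytope (productSet P Q) := by
  refine ⟨?_, (convex_productSet hP.convex hQ.convex).interior_nonempty_iff_affineSpan_eq_top.1
    (interior_productSet_nonempty hP.interior_nonempty hQ.interior_nonempty)⟩
  obtain ⟨⟨S, rfl⟩, -⟩ := hP
  obtain ⟨⟨T, rfl⟩, -⟩ := hQ
  refine ⟨(S ×ˢ T).image fun y => Sum.elim y.1 y.2, ?_⟩
  rw [productSet_eq_preimage, ← convexHull_prod]
  have h := (LinearEquiv.sumArrowLequivProdArrow ι κ ℝ ℝ).symm.toLinearMap.image_convexHull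
    (((fun z : ι → ℤ => fun i => (z i : ℝ)) '' (S : Set (ι → ℤ))) ×ˢ
      ((fun z : κ → ℤ => fun i => (z i : ℝ)) '' (T : Set (κ → ℤ))))
  refine h.trans (congrArg _ ?_)
  ext z
  constructor
  · rintro ⟨⟨x, y⟩, ⟨⟨u, hu, hux⟩, ⟨v, hv, hvy⟩⟩, rfl⟩
    refine ⟨Sum.elim u v, ?_, ?_⟩
    · exact Finset.mem_coe.2 (Finset.mem_image.2 ⟨(u, v), Finset.mem_product.2 ⟨hu, hv⟩, rfl⟩)
    · dsimp only at hux hvy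
      rw [← hux, ← hvy]
      funext i
      rcases i with i | i <;> rfl
  · rintro ⟨w, hw, rfl⟩
    obtain ⟨⟨u, v⟩, huv, rfl⟩ := Finset.mem_image.1 (Finset.mem_coe.1 hw)
    obtain ⟨hu, hv⟩ := Finset.mem_product.1 huv
    refine ⟨(fun i => (u i : ℝ), fun i => (v i : ℝ)), ⟨⟨u, hu, rfl⟩, ⟨v, hv, rfl⟩⟩, ?_⟩
    funext i
    rcases i with i | i <;> rfl

/-- A linear ordering of a finite set is given by an injective ranking. -/
lemma IsLinearOrderingOn.exists_rank {E : Type*} {V : Set E} {r : E → E → Prop}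
    (h : IsLinearOrderingOn V r) (hV : V.Finite) :
    ∃ α : E → ℕ, ∀ v ∈ V, ∀ w ∈ V, r v w ↔ α v ≤ α w := by
  -- The rank of `v` is the size of its down-set in `V`; down-sets of a linear order are nested.
  refine ⟨fun v => (hV.toFinset.filter fun u => r u v).card, fun v hv w hw => ?_⟩
  have hmono : ∀ v ∈ V, ∀ w ∈ V, r v w →
      (hV.toFinset.filter fun u => r u v) ⊆ hV.toFinset.filter fun u => r u w := by
    intro v hv w hw hvw u hu
    obtain ⟨huV, huv⟩ := Finset.mem_filter.1 hu
    exact Finset.mem_filter.2 ⟨huV, h.trans u (hV.mem_toFinset.1 huV) v hv w hw huv hvw⟩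
  refine ⟨fun hvw => Finset.card_le_card (hmono v hv w hw hvw), fun hle => ?_⟩
  by_contra hvw
  have hwv := (h.total v hv w hw).resolve_left hvw
  have heq := Finset.eq_of_subset_of_card_le (hmono w hw v hv hwv) hle
  have hmem : v ∈ hV.toFinset.filter fun u => r u v :=
    Finset.mem_filter.2 ⟨hV.mem_toFinset.2 hv, h.refl v hv⟩
  rw [← heq] at hmem
  exact hvw (Finset.mem_filter.1 hmem).2

lemma IsColorConsecutive.exists_ranking {E : Type*} {d : ℕ} {K : Set (Finset E)}
    {r : E → E → Prop} (h : IsColorConsecutive d K r) (hK : (vertices K).Finite) :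
    ∃ (c : E → Fin (d + 1)) (α : E → ℕ), IsColoring d K c ∧ IsColorRanking K c α ∧
      ∀ v ∈ vertices K, ∀ w ∈ vertices K, r v w ↔ α v ≤ α w := by
  obtain ⟨hr, c, hc, hmono⟩ := h
  obtain ⟨α, hα⟩ := hr.exists_rank hK
  refine ⟨c, α, hc, ⟨fun v hv w hw hvw => ?_, fun v hv w hw hvw => ?_⟩, hα⟩
  · exact hr.antisymm v hv w hw ((hα v hv w hw).2 hvw.le) ((hα w hw v hv).2 hvw.ge)
  · exact hmono v hv w hw ((hα v hv w hw).2 hvw)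

lemma IsRdfTriangulation.isColoredTriangulation {ι : Type*} [Fintype ι] {d : ℕ}
    {K : Set (Finset (ι → ℝ))} {P : Set (ι → ℝ)} (hK : IsRdfTriangulation K P)
    (hP : IsLatticePolytope P) {c : (ι → ℝ) → Fin (d + 1)} (hc : IsColoring d K c) :
    IsColoredTriangulation d K P c where
  triangulation := hK.triangulation
  convex := hP.convex
  interior_nonempty := hP.interior_nonempty
  lattice := by
    rw [hK.dense]
    exact Set.inter_subset_right
  coloring := hc

end Main

end

end RdfTriangulation

open RdfTriangulation in
theorem theorem4 (m n : ℕ) (P : Set (Fin m → ℝ)) (Q : Set (Fin n → ℝ))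
    (hP : IsLatticePolytope P) (hQ : IsLatticePolytope Q)
    (K : Set (Finset (Fin m → ℝ))) (L : Set (Finset (Fin n → ℝ)))
    (hK : IsRdfTriangulation K P) (hL : IsRdfTriangulation L Q)
    (OP : (Fin m → ℝ) → (Fin m → ℝ) → Prop) (OQ : (Fin n → ℝ) → (Fin n → ℝ) → Prop)
    (hOP : IsColorConsecutive m K OP) (hOQ : IsColorConsecutive n L OQ) :
    IsLatticePolytope (productSet P Q) ∧
    IsRdfTriangulation (simplicialProduct K L OP OQ) (productSet P Q) ∧
    signature (simplicialProduct K L OP OQ) =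
      staircaseSignature m n * signature K * signature L := by
  obtain ⟨c₁, α, hc₁, hα, hrα⟩ := hOP.exists_ranking (finite_vertices hK.triangulation.1)
  obtain ⟨c₂, β, hc₂, hβ, hrβ⟩ := hOQ.exists_ranking (finite_vertices hL.triangulation.1)
  have hKc := hK.isColoredTriangulation hP hc₁
  have hLc := hL.isColoredTriangulation hQ hc₂
  have hprod := hKc.rankedProduct hLc hα hβ
  -- All orderings are compared at vertices only, where they coincide with the orderings by rank.
  rw [simplicialProduct_eq_rankedProduct hKc.isComplex hLc.isComplex hrα hrβ]
  refine ⟨isLatticePolytope_productSet hP hQ, ⟨hprod.triangulation, ?_, ?_, ?_⟩,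
    signature_rankedProduct hKc hLc hα hβ⟩
  · exact isRegular_rankedProduct hK.triangulation hL.triangulation hP.convex hQ.convex
      hα.injOn hβ.injOn hK.regular hL.regular
  · rw [vertices_rankedProduct, hK.dense, hL.dense]
    ext z
    rw [Set.mem_inter_iff, mem_productSet, mem_latticePoints_iff]
    exact and_and_and_comm
  · have hcard : Fintype.card (Fin m ⊕ Fin n) = m + n := by simp
    rw [hcard]
    exact ⟨fun s hs => hprod.card_facet finSumFinEquiv hs, _, hprod.coloring⟩
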